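/- Let $N\ge 1$ and let $\Omega\subset\mathbb R^N$ be a nonempty bounded open set (for instance a bounded domain with Lipschitz boundary). For an integer $m\ge 2$ let $\mathcal L_m$ be the $m$-order logarithmic Laplacian, the operator with Fourier symbol $(2\log|\xi|)^m$. With $\hat u(\xi)=\int_\Omega e^{-ix\cdot\xi}u(x)\,dx$, let $\mathbb H_{m,0}(\Omega)\subset L^2(\Omega)$ be the closure of $C_c^\infty(\Omega)$ in the norm $\|u\|_m=\big(\int_{\mathbb R^N}(\log(e+|\xi|))^m|\hat u(\xi)|^2d\xi\big)^{1/2}$, and put $$(u,v)_m=\frac1{(2\pi)^N}\int_{\mathbb R^N}(2\log|\xi|)^m\,\hat u(\xi)\,\overline{\hat v(\xi)}\,d\xi .$$ A real number $\lambda$ is a Dirichlet eigenvalue of $\mathcal L_m$ in $\Omega$ if there is a nonzero $\phi\in\mathbb H_{m,0}(\Omega)$ with $(\phi,v)_m=\lambda\int_\Omega\phi v\,dx$ for all $v\in\mathbb H_{m,0}(\Omega)$. Let $\lambda_{m,1}(\Omega)\le\lambda_{m,2}(\Omega)\le\cdots$ be the Dirichlet eigenvalues, counted with multiplicity. Let $\omega_N$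 be the surface measure of the unit sphere in $\mathbb R^N$, $|\Omega|$ the Lebesgue measure of $\Omega$, and $$a_m=\frac{N^{m+1}}{2^m m}\,\frac{(2\pi)^N}{\omega_N},\qquad b_m=\frac{2^m}{N^m}(m-1)^m+\frac1{N^m},\qquad c_m=a_mb_m .$$ **Theorem 1.2.** For every integer $m\ge2$ there is a constant $\tau_0>1$, depending only on $m$, such that for all $N\ge 1$, all $\Omega\subset\mathbb R^N$ as above and all integers $k\ge 2$ the following holds. (i) If $m$ is even, or $m$ is odd and $\lambda_{m,1}(\Omega)\ge0$, then $$\lambda_{m,k}(\Omega)\ \ge\ \Big(\frac2N\Big)^m\min\Big\{\Big(\frac{c_m}{e^{\tau_0}}\Big)^{\frac m{m-1}}\Big(\frac{k}{|\Omega|}\Big)^{\frac m{m-1}},\ \Big(\log\Big(c_m\frac{k}{|\Omega|}+\tau_0^{m-1}e^{\tau_0}\Big)-(m-1)\log\log\Big(c_m\frac{k}{|\Omega|}+e\Big)-\log2\Big)^m\Big\}-b_m .$$ (ii) If $m$ is odd and $\lambda_{m,1}(\Omega)<0$, then, with $P_m(\Omega)=-\lambda_{m,1}(\Omega)+b_m$,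 $$\lambda_{m,k}(\Omega)\ \ge\ \Big(\frac2N\Big)^m\min\Big\{\Big(\frac{a_m}{e^{\tau_0}}\Big)^{\frac m{m-1}}\Big(\frac{P_m(\Omega)}{|\Omega|}\Big)^{\frac m{m-1}}k^{\frac m{m-1}},\ \Big(\log\Big(a_m\frac{P_m(\Omega)}{|\Omega|}k+\tau_0^{m-1}e^{\tau_0}\Big)-(m-1)\log\Big(2\log\Big(a_m\frac{P_m(\Omega)}{|\Omega|}k+e\Big)\Big)\Big)^m\Big\}-P_m(\Omega).$$ -/

import Mathlib

namespace LogLaplacian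

noncomputable section

/-- The real Hilbert space `L²(Ω)`, for `Ω ⊆ ℝᴺ`. -/
abbrev L2 {N : ℕ} (Ω : Set (EuclideanSpace ℝ (Fin N))) : Type :=
  MeasureTheory.Lp ℝ 2 ((MeasureTheory.volume : MeasureTheory.Measure
    (EuclideanSpace ℝ (Fin N))).restrict Ω)

/-- The Fourier transform `û(ξ) = ∫_Ω e^{-i x·ξ} u(x) dx` of the extension by zero of a function `u`
on `Ω`. For bounded `Ω` and `u ∈ L²(Ω)` the integral converges absolutely. -/
def hat {N : ℕ} (Ω : Set (EuclideanSpace ℝ (Fin N))) (u : EuclideanSpace ℝ (Fin N) → ℝ)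
    (ξ : EuclideanSpace ℝ (Fin N)) : ℂ :=
  ∫ x in Ω, Complex.exp (-(Complex.I * ((inner ℝ x ξ : ℝ) : ℂ))) * ((u x : ℝ) : ℂ)

/-- The squared norm `‖u‖_m² = ∫ (log (e + |ξ|))^m |û(ξ)|² dξ`, possibly infinite. -/
def normSq (m : ℕ) {N : ℕ} (Ω : Set (EuclideanSpace ℝ (Fin N)))
    (u : EuclideanSpace ℝ (Fin N) → ℝ) : ENNReal :=
  ∫⁻ ξ, ENNReal.ofReal ((Real.log (Real.exp 1 + ‖ξ‖)) ^ m * ‖hat Ω u ξ‖ ^ 2)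

/-- `φ` is a test function on `Ω`, that is, `φ ∈ C_c^∞(Ω)`. -/
def IsTestFunction {N : ℕ} (Ω : Set (EuclideanSpace ℝ (Fin N)))
    (φ : EuclideanSpace ℝ (Fin N) → ℝ) : Prop :=
  ContDiff ℝ ((⊤ : ℕ∞) : WithTop ℕ∞) φ ∧ HasCompactSupport φ ∧ tsupport φ ⊆ Ω

/-- The energy space `ℍ_{m,0}(Ω)`: the closure of `C_c^∞(Ω)` with respect to `‖·‖_m`, realized as
a subset of `L²(Ω)` (note that `‖·‖_m` dominates a multiple of the `L²` norm). -/
def energySpace (m : ℕ) {N : ℕ} (Ω : Set (EuclideanSpace ℝ (Fin N))) : Set (L2 Ω) :=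
  {u | ∀ ε : ENNReal, 0 < ε → ∃ φ : EuclideanSpace ℝ (Fin N) → ℝ,
    IsTestFunction Ω φ ∧ normSq m Ω (fun x => u x - φ x) < ε}

/-- The symmetric bilinear form of the `m`-order logarithmic Laplacian,
`(u, v)_m = (2π)^{-N} ∫ (2 log |ξ|)^m û(ξ) conj(v̂(ξ)) dξ`. For real `u`, `v` the imaginary part of
the integrand is odd, so that only the real part contributes. -/
def form (m : ℕ) {N : ℕ} (Ω : Set (EuclideanSpace ℝ (Fin N))) (u v : L2 Ω) : ℝ :=
  ((2 * Real.pi) ^ N)⁻¹ *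
    ∫ ξ : EuclideanSpace ℝ (Fin N), (2 * Real.log ‖ξ‖) ^ m *
      (hat Ω (fun x => u x) ξ * (starRingEnd ℂ) (hat Ω (fun x => v x) ξ)).re

/-- `φ` is a Dirichlet eigenfunction of the `m`-order logarithmic Laplacian in `Ω` with
eigenvalue `μ`: `φ ∈ ℍ_{m,0}(Ω)`, `φ ≠ 0`, and `(φ, v)_m = μ ∫_Ω φ v` for all
`v ∈ ℍ_{m,0}(Ω)`. -/
def IsEigenfunction (m : ℕ) {N : ℕ} (Ω : Set (EuclideanSpace ℝ (Fin N))) (μ : ℝ) (φ : L2 Ω) :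
    Prop :=
  φ ∈ energySpace m Ω ∧ φ ≠ 0 ∧
    ∀ v ∈ energySpace m Ω, form m Ω φ v = μ * inner ℝ φ v

/-- There are at least `k` Dirichlet eigenvalues `≤ t`, counted with multiplicity: there are `k`
eigenfunctions, orthonormal in `L²(Ω)`, whose eigenvalues are `≤ t`. -/
def HasEigenvaluesBelow (m : ℕ) {N : ℕ} (Ω : Set (EuclideanSpace ℝ (Fin N))) (k : ℕ) (t : ℝ) :
    Prop :=
  ∃ (μ : Fin k → ℝ) (φ : Fin k → L2 Ω), Orthonormal ℝ φ ∧
    ∀ i, IsEigenfunction m Ω (μ i) (φ i) ∧ μ i ≤ t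

/-- The `k`-th Dirichlet eigenvalue `λ_{m,k}(Ω)` (`k ≥ 1`), in nondecreasing order and counted with
multiplicity: the least `t` such that at least `k` eigenvalues are `≤ t`. -/
def eigenvalue (m : ℕ) {N : ℕ} (Ω : Set (EuclideanSpace ℝ (Fin N))) (k : ℕ) : ℝ :=
  sInf {t : ℝ | HasEigenvaluesBelow m Ω k t}

/-- `ω_N`, the `(N-1)`-dimensional volume (surface measure) of the unit sphere of `ℝᴺ`. -/
def sphereVolume (N : ℕ) : ℝ :=
  ((MeasureTheory.volume : MeasureTheory.Measure
    (EuclideanSpace ℝ (Fin N))).toSphere Set.univ).toReal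

/-- `a_m = N^{m+1} / (2^m m) · (2π)^N / ω_N`. -/
def coeffA (N m : ℕ) : ℝ :=
  (N : ℝ) ^ (m + 1) / (2 ^ m * (m : ℝ)) * ((2 * Real.pi) ^ N / sphereVolume N)

/-- `b_m = 2^m / N^m · (m-1)^m + 1 / N^m`. -/
def coeffB (N m : ℕ) : ℝ :=
  2 ^ m / (N : ℝ) ^ m * ((m : ℝ) - 1) ^ m + 1 / (N : ℝ) ^ m

/-- `c_m = a_m b_m`. -/
def coeffC (N m : ℕ) : ℝ :=
  coeffA N m * coeffB N m

/-- `P_m(Ω) = -λ_{m,1}(Ω) + b_m`. -/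
def shiftP (m : ℕ) {N : ℕ} (Ω : Set (EuclideanSpace ℝ (Fin N))) : ℝ :=
  -eigenvalue m Ω 1 + coeffB N m

/-- The Lebesgue measure `|Ω|`. -/
def vol {N : ℕ} (Ω : Set (EuclideanSpace ℝ (Fin N))) : ℝ :=
  (MeasureTheory.volume Ω).toReal

end

end LogLaplacian

open LogLaplacian

namespace LogLaplacian

open MeasureTheory FourierTransform SchwartzMap Real Set Filter Topology

/-! ### Plancherel's identity on L¹ ∩ L². -/

section Plancherel

variable {E : Type*} [NormedAddCommGroup E] [InnerProductSpace ℝ E] [FiniteDimensional ℝ E]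
  [MeasurableSpace E] [BorelSpace E]

/-! The proof is a Berezin–Li–Yau argument. Let `φ₁, …, φ_k` be orthonormal eigenfunctions with
eigenvalues at most `t`. Bessel's inequality against the characters on `Ω` gives `∑ |φ̂ᵢ(ξ)|² ≤ |Ω|`
for every `ξ` (`sum_norm_sq_hat_le`), and Plancherel gives each `|φ̂ᵢ|²` total mass `(2π)^N`
(`integral_norm_sq_hat`). Compare the symbol with its value `(2τ/N)^m` at radius `e^{τ/N}`. The
shortfall below that level has a nonnegative majorant whose integral is at most `ω_N m 2^m
N^{-(m+1)} τ^{m-1} e^τ` (`exists_log_defect`). Summing the eigenvalue identities yields `t ≥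
(2τ/N)^m - τ^{m-1} e^τ / (a_m k/|Ω|)` for all `τ` above a threshold depending only on `m`
(`HasEigenvaluesBelow.le`).

For `p > 0`, choosing `τ` with `τ^{m-1} e^τ = X := a_m p k/|Ω|` turns this into `λ_k ≥ (2τ/N)^m - p`
(`le_eigenvalue`). The two parts of the theorem are `p = b_m` and `p = P_m`. It remains to bound
`τ^m` below by explicit functions of `X`: a power of `X` when `τ ≤ τ₀`, an iterated logarithm when
`τ ≥ τ₀`. The minimum of the two covers both ranges. If `X` is too small for an admissible `τ`, the
first entry of the minimum is at most 1, and a trivial bound on `λ_k` suffices.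

Since `λ_k` is an infimum over real numbers, and the infimum of the empty set is 0 by convention, it
must also be shown that at least `k` eigenvalues exist. This is the variational part: a Gårding
inequality, compactness of the energy space in `L²(Ω)`, and successive minimisation of the form on
orthogonal complements. -/

theorem continuous_fourier_of_integrable {g : E → ℂ} (hg : Integrable g) : Continuous (𝓕 g) :=
  VectorFourier.fourierIntegral_continuous continuous_fourierChar
    (by exact continuous_inner) hg

/-- On `L¹ ∩ L²` the Fourier integral represents the `L²` Fourier transform. -/
theorem fourier_ae_eq_fourier_toLp {g : E → ℂ} (h1 : Integrable g volume) (h2 : MemLp g 2 volume) :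
    𝓕 g =ᵐ[volume] (𝓕 (h2.toLp g) : Lp ℂ 2 (volume : Measure E)) := by
  -- Both sides are locally integrable, so they may be compared against smooth compactly supported
  -- functions. There the integral transform is moved onto the test function by Fubini, and the `L²`
  -- transform by its agreement with the distributional one.
  refine ae_eq_of_integral_contDiff_smul_eq (continuous_fourier_of_integrable h1).locallyIntegrable
    ((Lp.memLp _).locallyIntegrable (by norm_num)) ?_
  intro φ hφ hφc
  have hc : HasCompactSupport (fun x => (φ x : ℂ)) := hφc.comp_left (g := Complex.ofReal) (by simp)
  have hd : ContDiff ℝ ((⊤ : ℕ∞) : WithTop ℕ∞) (fun x => (φ x : ℂ)) :=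
    Complex.ofRealCLM.contDiff.comp hφ
  let ψ : 𝓢(E, ℂ) := hc.toSchwartzMap hd
  have hψ : ∀ x, ψ x = (φ x : ℂ) := fun x => rfl
  have key := congrArg (fun T => T ψ) (Lp.fourier_toTemperedDistribution_eq (h2.toLp g))
  simp only [TemperedDistribution.fourier_apply, Lp.toTemperedDistribution_apply] at key
  have h3 : ∫ x, 𝓕 g x • ψ x = ∫ x, g x • 𝓕 (ψ : E → ℂ) x := by
    simpa using! VectorFourier.integral_fourierIntegral_smul_eq_flip (L := innerₗ E)
      continuous_fourierChar continuous_inner h1 ψ.integrable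
  calc ∫ x, φ x • 𝓕 g x = ∫ x, 𝓕 g x • ψ x := by
        congr 1; ext x; simp [hψ, mul_comm]
    _ = ∫ x, g x • 𝓕 (ψ : E → ℂ) x := h3
    _ = ∫ x, (𝓕 ψ) x • (h2.toLp g) x := by
        refine integral_congr_ae ?_
        filter_upwards [h2.coeFn_toLp] with x hx
        rw [hx, SchwartzMap.fourier_coe, smul_eq_mul, smul_eq_mul, mul_comm]
    _ = _ := by
        rw [key]
        congr 1

theorem memLp_fourier {g : E → ℂ} (h1 : Integrable g volume) (h2 : MemLp g 2 volume) : MemLp (𝓕 g) 2 volume :=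
  MemLp.ae_eq (fourier_ae_eq_fourier_toLp h1 h2).symm (Lp.memLp _)

theorem integral_norm_sq_coe {α : Type*} [MeasurableSpace α] {μ : Measure α} {F : Type*}
    [NormedAddCommGroup F] [InnerProductSpace ℝ F] (f : Lp F 2 μ) :
    ∫ x, ‖f x‖ ^ 2 ∂μ = ‖f‖ ^ 2 := by
  rw [← real_inner_self_eq_norm_sq, L2.inner_def]
  simp_rw [real_inner_self_eq_norm_sq]

theorem integral_norm_sq_fourier_eq {g : E → ℂ} (h1 : Integrable g volume) (h2 : MemLp g 2 volume) :
    ∫ x, ‖𝓕 g x‖ ^ 2 = ∫ x, ‖g x‖ ^ 2 := by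
  calc ∫ x, ‖𝓕 g x‖ ^ 2 = ∫ x, ‖(𝓕 (h2.toLp g) : Lp ℂ 2 (volume : Measure E)) x‖ ^ 2 := by
        refine integral_congr_ae ?_
        filter_upwards [fourier_ae_eq_fourier_toLp h1 h2] with x hx
        rw [hx]
    _ = ‖h2.toLp g‖ ^ 2 := by rw [integral_norm_sq_coe, Lp.norm_fourier_eq]
    _ = _ := by
        rw [← integral_norm_sq_coe]
        refine integral_congr_ae ?_
        filter_upwards [h2.coeFn_toLp] with x hx
        rw [hx]

end Plancherel

/-! ### Fourier transforms of functions in `L²(Ω)`: Bessel and Plancherel. -/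

section Hat

variable {N : ℕ} {Ω : Set (EuclideanSpace ℝ (Fin N))}

/-- `𝓕` uses the kernel `e^{-2πi x·ξ}`. The change of frequency variable is the source of the factor
`(2π)^N` in Plancherel's identity. -/
theorem hat_eq_fourier (hΩ : MeasurableSet Ω) (u : EuclideanSpace ℝ (Fin N) → ℝ)
    (ξ : EuclideanSpace ℝ (Fin N)) :
    hat Ω u ξ = 𝓕 (Ω.indicator fun x => (u x : ℂ)) ((2 * π)⁻¹ • ξ) := by
  rw [Real.fourier_eq', hat, ← integral_indicator hΩ]
  congr 1
  ext x
  by_cases hx : x ∈ Ω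
  · simp only [indicator_of_mem hx, smul_eq_mul, inner_smul_right]
    congr 2
    push_cast
    field_simp
  · simp [hx]

theorem hat_congr {u v : EuclideanSpace ℝ (Fin N) → ℝ} (h : u =ᵐ[volume.restrict Ω] v) :
    hat Ω u = hat Ω v := by
  ext ξ
  refine integral_congr_ae ?_
  filter_upwards [h] with x hx
  rw [hx]

variable [IsFiniteMeasure ((volume : Measure (EuclideanSpace ℝ (Fin N))).restrict Ω)]

variable (Ω) in
/-- The character `x ↦ cos (x·ξ)` as an element of `L²(Ω)`. -/
noncomputable def cosL2 (ξ : EuclideanSpace ℝ (Fin N)) : L2 Ω :=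
  MemLp.toLp (fun x : EuclideanSpace ℝ (Fin N) => cos (inner ℝ x ξ))
    (MemLp.of_bound (by fun_prop) 1 (ae_of_all _ fun x => by
      simpa using abs_cos_le_one _))

variable (Ω) in
/-- The character `x ↦ sin (x·ξ)` as an element of `L²(Ω)`. -/
noncomputable def sinL2 (ξ : EuclideanSpace ℝ (Fin N)) : L2 Ω :=
  MemLp.toLp (fun x : EuclideanSpace ℝ (Fin N) => sin (inner ℝ x ξ))
    (MemLp.of_bound (by fun_prop) 1 (ae_of_all _ fun x => by
      simpa using abs_sin_le_one _))

theorem coeFn_cosL2 (ξ : EuclideanSpace ℝ (Fin N)) :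
    cosL2 Ω ξ =ᵐ[volume.restrict Ω] fun x => cos (inner ℝ x ξ) := MemLp.coeFn_toLp _

theorem coeFn_sinL2 (ξ : EuclideanSpace ℝ (Fin N)) :
    sinL2 Ω ξ =ᵐ[volume.restrict Ω] fun x => sin (inner ℝ x ξ) := MemLp.coeFn_toLp _

theorem norm_sq_cosL2_add (ξ : EuclideanSpace ℝ (Fin N)) :
    ‖cosL2 Ω ξ‖ ^ 2 + ‖sinL2 Ω ξ‖ ^ 2 = vol Ω := by
  have hv : vol Ω = ∫ x in Ω, (1 : ℝ) := by simp [vol, Measure.real]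
  rw [← integral_norm_sq_coe, ← integral_norm_sq_coe, ← integral_add, hv]
  · refine integral_congr_ae ?_
    filter_upwards [coeFn_cosL2 (Ω := Ω) ξ, coeFn_sinL2 (Ω := Ω) ξ] with x h1 h2
    rw [h1, h2]
    simp
  · simpa using (Lp.memLp (cosL2 Ω ξ)).integrable_norm_pow (by norm_num)
  · simpa using (Lp.memLp (sinL2 Ω ξ)).integrable_norm_pow (by norm_num)

theorem integrable_coe_L2 (u : L2 Ω) : Integrable u (volume.restrict Ω) :=
  (Lp.memLp u).integrable (by norm_num)

/-- `L²(Ω)` is a real Hilbert space, so the complex exponential is split into two real vectors.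
Linearity, Bessel, the pointwise bound and weak continuity of `û(ξ)` all become statements about
inner products with them. -/
theorem hat_re_im (u : L2 Ω) (ξ : EuclideanSpace ℝ (Fin N)) :
    hat Ω u ξ = ((inner ℝ (cosL2 Ω ξ) u : ℝ) : ℂ) - ((inner ℝ (sinL2 Ω ξ) u : ℝ) : ℂ) * Complex.I := by
  have hc : (inner ℝ (cosL2 Ω ξ) u : ℝ) = ∫ x in Ω, cos (inner ℝ x ξ) * u x := by
    rw [L2.inner_def]
    refine integral_congr_ae ?_
    filter_upwards [coeFn_cosL2 (Ω := Ω) ξ] with x h1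
    rw [h1]; simp [mul_comm]
  have hs : (inner ℝ (sinL2 Ω ξ) u : ℝ) = ∫ x in Ω, sin (inner ℝ x ξ) * u x := by
    rw [L2.inner_def]
    refine integral_congr_ae ?_
    filter_upwards [coeFn_sinL2 (Ω := Ω) ξ] with x h1
    rw [h1]; simp [mul_comm]
  have ic : Integrable (fun x => cos (inner ℝ x ξ) * u x) (volume.restrict Ω) :=
    (integrable_coe_L2 u).bdd_mul (by fun_prop) (c := 1)
      (ae_of_all _ fun x => by simpa using abs_cos_le_one _)
  have is : Integrable (fun x => sin (inner ℝ x ξ) * u x) (volume.restrict Ω) :=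
    (integrable_coe_L2 u).bdd_mul (by fun_prop) (c := 1)
      (ae_of_all _ fun x => by simpa using abs_sin_le_one _)
  rw [hc, hs, ← integral_complex_ofReal, ← integral_complex_ofReal, ← integral_mul_const,
    ← integral_sub ic.ofReal (is.ofReal.mul_const _), hat]
  congr 1
  ext x
  rw [mul_comm Complex.I, ← neg_mul, Complex.exp_mul_I]
  simp only [Complex.ofReal_mul, Complex.ofReal_cos, Complex.ofReal_sin, Complex.cos_neg,
    Complex.sin_neg]
  ring

theorem hat_add (u v : L2 Ω) (ξ : EuclideanSpace ℝ (Fin N)) :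
    hat Ω (u + v : L2 Ω) ξ = hat Ω u ξ + hat Ω v ξ := by
  simp only [hat_re_im, inner_add_right, Complex.ofReal_add]
  ring

theorem hat_smul (c : ℝ) (u : L2 Ω) (ξ : EuclideanSpace ℝ (Fin N)) :
    hat Ω (c • u : L2 Ω) ξ = c * hat Ω u ξ := by
  simp only [hat_re_im, inner_smul_right, Complex.ofReal_mul]
  ring

theorem hat_sub (u v : L2 Ω) (ξ : EuclideanSpace ℝ (Fin N)) :
    hat Ω (u - v : L2 Ω) ξ = hat Ω u ξ - hat Ω v ξ := by
  simp only [hat_re_im, inner_sub_right, Complex.ofReal_sub]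
  ring

theorem norm_sq_hat (u : L2 Ω) (ξ : EuclideanSpace ℝ (Fin N)) :
    ‖hat Ω u ξ‖ ^ 2 = (inner ℝ (cosL2 Ω ξ) u : ℝ) ^ 2 + (inner ℝ (sinL2 Ω ξ) u : ℝ) ^ 2 := by
  rw [hat_re_im, ← Complex.normSq_eq_norm_sq, Complex.normSq_apply]
  simp
  ring

/-- Bessel's inequality for the Fourier transforms of an orthonormal family. -/
theorem sum_norm_sq_hat_le {k : ℕ} {φ : Fin k → L2 Ω} (hφ : Orthonormal ℝ φ)
    (ξ : EuclideanSpace ℝ (Fin N)) : ∑ i, ‖hat Ω (φ i) ξ‖ ^ 2 ≤ vol Ω := by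
  simp_rw [norm_sq_hat, Finset.sum_add_distrib]
  rw [← norm_sq_cosL2_add ξ]
  refine add_le_add ?_ ?_
  · simpa [real_inner_comm] using hφ.sum_inner_products_le (cosL2 Ω ξ) (s := Finset.univ)
  · simpa [real_inner_comm] using hφ.sum_inner_products_le (sinL2 Ω ξ) (s := Finset.univ)

theorem norm_sq_hat_le (u : L2 Ω) (ξ : EuclideanSpace ℝ (Fin N)) :
    ‖hat Ω u ξ‖ ^ 2 ≤ vol Ω * ‖u‖ ^ 2 := by
  rw [norm_sq_hat, ← norm_sq_cosL2_add ξ, add_mul, ← mul_pow, ← mul_pow]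
  refine add_le_add ?_ ?_ <;>
  · rw [sq_le_sq, abs_mul, abs_norm, abs_norm]
    exact abs_real_inner_le_norm _ _

theorem tendsto_hat {ι : Type*} {l : Filter ι} {u : ι → L2 Ω} {v : L2 Ω}
    (h : ∀ w : L2 Ω, Tendsto (fun n => (inner ℝ w (u n) : ℝ)) l (𝓝 (inner ℝ w v)))
    (ξ : EuclideanSpace ℝ (Fin N)) : Tendsto (fun n => hat Ω (u n) ξ) l (𝓝 (hat Ω v ξ)) := by
  simp only [hat_re_im]
  exact ((Complex.continuous_ofReal.tendsto _).comp (h _)).sub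
    (((Complex.continuous_ofReal.tendsto _).comp (h _)).mul_const _)

theorem integrable_indicator_coe (hΩ : MeasurableSet Ω) (u : L2 Ω) :
    Integrable (Ω.indicator fun x => (u x : ℂ)) :=
  (integrable_indicator_iff hΩ).2 (integrable_coe_L2 u).ofReal

omit [IsFiniteMeasure ((volume : Measure (EuclideanSpace ℝ (Fin N))).restrict Ω)] in
theorem memLp_indicator_coe (hΩ : MeasurableSet Ω) (u : L2 Ω) :
    MemLp (Ω.indicator fun x => (u x : ℂ)) 2 :=
  (memLp_indicator_iff_restrict hΩ).2 (Lp.memLp u).ofReal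

theorem continuous_hat (hΩ : MeasurableSet Ω) (u : L2 Ω) : Continuous (hat Ω u) := by
  have : hat Ω u = fun ξ => 𝓕 (Ω.indicator fun x => (u x : ℂ)) ((2 * π)⁻¹ • ξ) :=
    funext (hat_eq_fourier hΩ u)
  rw [this]
  exact (continuous_fourier_of_integrable (integrable_indicator_coe hΩ u)).comp
    (continuous_const_smul _)

theorem integrable_norm_sq_hat (hΩ : MeasurableSet Ω) (u : L2 Ω) :
    Integrable fun ξ => ‖hat Ω u ξ‖ ^ 2 := by
  simp_rw [hat_eq_fourier hΩ]
  have h := (memLp_fourier (integrable_indicator_coe hΩ u)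
    (memLp_indicator_coe hΩ u)).integrable_norm_pow (by norm_num)
  exact (integrable_comp_smul_iff volume
    (fun ξ => ‖𝓕 (Ω.indicator fun x => (u x : ℂ)) ξ‖ ^ 2) (by positivity)).2 (by simpa using h)

/-- Plancherel's identity. -/
theorem integral_norm_sq_hat (hΩ : MeasurableSet Ω) (u : L2 Ω) :
    ∫ ξ, ‖hat Ω u ξ‖ ^ 2 = (2 * π) ^ N * ‖u‖ ^ 2 := by
  simp_rw [hat_eq_fourier hΩ]
  rw [Measure.integral_comp_smul volume
    (fun ξ => ‖𝓕 (Ω.indicator fun x => (u x : ℂ)) ξ‖ ^ 2), integral_norm_sq_fourier_eq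
    (integrable_indicator_coe hΩ u) (memLp_indicator_coe hΩ u), ← integral_norm_sq_coe]
  have : (fun x => ‖Ω.indicator (fun x => (u x : ℂ)) x‖ ^ 2)
      = Ω.indicator fun x => ‖u x‖ ^ 2 := by
    ext x
    by_cases hx : x ∈ Ω <;> simp [hx]
  rw [this, integral_indicator hΩ, finrank_euclideanSpace_fin, inv_pow, inv_inv,
    abs_of_pos (by positivity), smul_eq_mul]

end Hat

end LogLaplacian

namespace LogLaplacian

open MeasureTheory FourierTransform SchwartzMap Real Set Filter Topology

/-! ### The integrable majorant of the logarithmic symbol's defect. -/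

section LogWeight

/-- With `x = -(N/2) log r`, this is `x^m / m! ≤ e^x`. Scaling by `N` makes the singularity at the
origin integrable against `r^{N-1}`, with a constant that matches the homogeneity `N^{-(m+1)}` of
the main term, so the threshold on `τ` does not depend on `N`. -/
theorem abs_two_mul_log_pow_le {N : ℕ} (hN : 1 ≤ N) (m : ℕ) {r : ℝ} (h0 : 0 < r) (h1 : r ≤ 1) :
    |2 * log r| ^ m ≤ (4 / N : ℝ) ^ m * m.factorial * r ^ (-(N : ℝ) / 2) := by
  have hN' : (0 : ℝ) < N := by exact_mod_cast hN
  have hl : log r ≤ 0 := log_nonpos h0.le h1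
  set x : ℝ := -(N * log r / 2) with hx
  have hx0 : 0 ≤ x := by rw [hx]; nlinarith
  have h2 : |2 * log r| = 4 / N * x := by
    rw [abs_of_nonpos (by linarith), hx]
    field_simp
    ring
  have h3 : r ^ (-(N : ℝ) / 2) = exp x := by
    rw [rpow_def_of_pos h0, hx]
    congr 1
    ring
  rw [h2, h3, mul_pow, mul_assoc]
  gcongr
  have := pow_div_factorial_le_exp x hx0 m
  rwa [div_le_iff₀ (by positivity), mul_comm] at this

/-- The tangent line bound from convexity. It replaces the `m`-th power of the logarithm by a first
power, whose radial integral is elementary and keeps the right leading term. -/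
theorem pow_sub_pow_le_mul_sub {a b : ℝ} (hb : 0 ≤ b) (h : b ≤ a) (m : ℕ) :
    a ^ m - b ^ m ≤ m * a ^ (m - 1) * (a - b) := by
  have ha : 0 ≤ a := hb.trans h
  rcases m with _ | n
  · simp
  induction n with
  | zero => simp
  | succ n ih =>
    have h1 : b ^ (n + 1) ≤ a ^ (n + 1) := by gcongr
    simp only [Nat.add_sub_cancel] at ih ⊢
    have h2 : a ^ (n + 1 + 1) - b ^ (n + 1 + 1)
        = a * (a ^ (n + 1) - b ^ (n + 1)) + b ^ (n + 1) * (a - b) := by ring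
    have h3 : a * (a ^ (n + 1) - b ^ (n + 1)) ≤ a * (((n + 1 : ℕ) : ℝ) * a ^ n * (a - b)) := by
      gcongr
    have h4 : b ^ (n + 1) * (a - b) ≤ a ^ (n + 1) * (a - b) := by
      gcongr
    push_cast at h3 ⊢
    rw [h2]
    calc _ ≤ _ := add_le_add h3 h4
      _ = _ := by ring

theorem hasDerivAt_pow_mul_sub_log {N : ℕ} (hN : 1 ≤ N) (l : ℝ) {y : ℝ} (hy : 0 < y) :
    HasDerivAt (fun y : ℝ => y ^ N / N * (l - log y) + y ^ N / (N : ℝ) ^ 2)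
      (y ^ (N - 1) * (l - log y)) y := by
  have hN' : (N : ℝ) ≠ 0 := by positivity
  have h1 := ((hasDerivAt_pow N y).div_const (N : ℝ)).mul ((hasDerivAt_log hy.ne').const_sub l)
  have h2 := (hasDerivAt_pow N y).div_const ((N : ℝ) ^ 2)
  refine (h1.add h2).congr_deriv ?_
  obtain ⟨n, rfl⟩ : ∃ n, N = n + 1 := ⟨N - 1, by omega⟩
  simp only [Nat.add_sub_cancel, pow_succ] at *
  field_simp
  ring

theorem integral_pow_mul_sub_log {N : ℕ} (hN : 1 ≤ N) {l : ℝ} (hl : 0 ≤ l) :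
    ∫ y in Ioc 1 (exp l), y ^ (N - 1) * (l - log y) = (exp (N * l) - 1 - N * l) / (N : ℝ) ^ 2 := by
  have hN' : (N : ℝ) ≠ 0 := by positivity
  have h1 : (1 : ℝ) ≤ exp l := one_le_exp hl
  rw [← intervalIntegral.integral_of_le h1,
    intervalIntegral.integral_eq_sub_of_hasDerivAt
      (f := fun y : ℝ => y ^ N / N * (l - log y) + y ^ N / (N : ℝ) ^ 2)]
  · simp only [log_exp, log_one, one_pow, ← exp_nat_mul]
    field_simp
    ring
  · intro y hy
    rw [uIcc_of_le h1] at hy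
    exact hasDerivAt_pow_mul_sub_log hN l (by linarith [hy.1])
  · refine ContinuousOn.intervalIntegrable ?_
    rw [uIcc_of_le h1]
    refine (by fun_prop : Continuous fun y : ℝ => y ^ (N - 1)).continuousOn.mul
      (continuousOn_const.sub (continuousOn_log.mono ?_))
    intro y hy
    have := hy.1
    simp only [mem_compl_iff, mem_singleton_iff]
    linarith

theorem integrableOn_pow_mul_sub_log (N : ℕ) (l : ℝ) :
    IntegrableOn (fun y : ℝ => y ^ (N - 1) * (l - log y)) (Ioc 1 (exp l)) := by
  refine IntegrableOn.mono_set (ContinuousOn.integrableOn_compact isCompact_Icc ?_)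
    (t := Icc 1 (exp l)) Ioc_subset_Icc_self
  refine (by fun_prop : Continuous fun y : ℝ => y ^ (N - 1)).continuousOn.mul
      (continuousOn_const.sub (continuousOn_log.mono ?_))
  intro y hy
  have := hy.1
  simp only [mem_compl_iff, mem_singleton_iff]
  linarith

theorem integrableOn_pow_mul_add_rpow {N : ℕ} (hN : 1 ≤ N) (L K : ℝ) :
    IntegrableOn (fun y : ℝ => y ^ (N - 1) * (L + K * y ^ (-(N : ℝ) / 2))) (Ioc 0 1) ∧
      ∫ y in Ioc 0 1, y ^ (N - 1) * (L + K * y ^ (-(N : ℝ) / 2)) = L / N + 2 * K / N := by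
  have hN' : (1 : ℝ) ≤ N := by exact_mod_cast hN
  have hN0 : (N : ℝ) ≠ 0 := by positivity
  have e : EqOn (fun y : ℝ => y ^ (N - 1) * (L + K * y ^ (-(N : ℝ) / 2)))
      (fun y : ℝ => L * y ^ ((N : ℝ) - 1) + K * y ^ ((N : ℝ) / 2 - 1)) (Ioc 0 1) := by
    intro y hy
    have h1 : y ^ (N - 1) = y ^ ((N : ℝ) - 1) := by
      rw [← rpow_natCast]; congr 1; push_cast [hN]; ring
    have h2 : y ^ ((N : ℝ) / 2 - 1) = y ^ ((N : ℝ) - 1) * y ^ (-(N : ℝ) / 2) := by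
      rw [← rpow_add hy.1]; congr 1; ring
    simp only [h1, h2]
    ring
  have i1 : IntervalIntegrable (fun y : ℝ => y ^ ((N : ℝ) - 1)) volume 0 1 :=
    intervalIntegral.intervalIntegrable_rpow' (by linarith)
  have i2 : IntervalIntegrable (fun y : ℝ => y ^ ((N : ℝ) / 2 - 1)) volume 0 1 :=
    intervalIntegral.intervalIntegrable_rpow' (by linarith)
  refine ⟨?_, ?_⟩
  · refine IntegrableOn.congr_fun ?_ e.symm measurableSet_Ioc
    exact (intervalIntegrable_iff_integrableOn_Ioc_of_le zero_le_one).1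
      ((i1.const_mul L).add (i2.const_mul K))
  · rw [setIntegral_congr_fun measurableSet_Ioc e, ← intervalIntegral.integral_of_le zero_le_one,
      intervalIntegral.integral_add (i1.const_mul L) (i2.const_mul K),
      intervalIntegral.integral_const_mul, intervalIntegral.integral_const_mul,
      integral_rpow (Or.inl (by linarith)), integral_rpow (Or.inl (by linarith))]
    have h1 : (N : ℝ) - 1 + 1 = N := by ring
    have h2 : (N : ℝ) / 2 - 1 + 1 = N / 2 := by ring
    rw [h1, h2, one_rpow, one_rpow, zero_rpow hN0, zero_rpow (by positivity)]
    field_simp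
    ring

/-- Polar coordinates, with `ω_N` identified as `N` times the volume of the unit ball. -/
theorem integral_indicator_norm {N : ℕ} (hN : 1 ≤ N) {s t : Set ℝ} (hs : MeasurableSet s)
    (hs0 : Ioi 0 ∩ s = t) {f : ℝ → ℝ} (hf : IntegrableOn (fun y => y ^ (N - 1) * f y) t) :
    Integrable (fun ξ : EuclideanSpace ℝ (Fin N) => s.indicator f ‖ξ‖) ∧
      ∫ ξ : EuclideanSpace ℝ (Fin N), s.indicator f ‖ξ‖
        = sphereVolume N * ∫ y in t, y ^ (N - 1) * f y := by
  have : Nonempty (Fin N) := ⟨⟨0, hN⟩⟩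
  have e : (fun y : ℝ => y ^ (N - 1) • s.indicator f y)
      = s.indicator fun y => y ^ (N - 1) * f y := by
    ext y
    by_cases hy : y ∈ s <;> simp [hy]
  refine ⟨?_, ?_⟩
  · rw [integrable_fun_norm_addHaar, finrank_euclideanSpace_fin, e, integrableOn_indicator_iff hs,
      inter_comm, hs0]
    exact hf
  · rw [integral_fun_norm_addHaar, finrank_euclideanSpace_fin, e, setIntegral_indicator hs, hs0,
      sphereVolume, ← Measure.real, Measure.toSphere_real_apply_univ, finrank_euclideanSpace_fin,
      nsmul_eq_mul, smul_eq_mul, mul_assoc]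

/-- A nonnegative integrable majorant of the defect `(2τ/N)^m - (2 log |ξ|)^m`, with a sharp
integral. -/
theorem exists_log_defect {N m : ℕ} (hN : 1 ≤ N) (hm : 2 ≤ m) {τ : ℝ}
    (hτ : 2 ^ (m + 1) * m.factorial ≤ τ) :
    ∃ g : EuclideanSpace ℝ (Fin N) → ℝ, Integrable g ∧ (∀ ξ, 0 ≤ g ξ) ∧
      (∀ ξ, (2 * τ / N) ^ m - (2 * log ‖ξ‖) ^ m ≤ g ξ) ∧
      (∀ ξ, ‖ξ‖ ≤ 1 → |2 * log ‖ξ‖| ^ m ≤ g ξ) ∧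
      ∫ ξ, g ξ ≤ sphereVolume N * (m * 2 ^ m / N ^ (m + 1) * (τ ^ (m - 1) * exp τ)) := by
  have hN' : (0 : ℝ) < N := by exact_mod_cast hN
  have hfac : (1 : ℝ) ≤ 2 ^ (m + 1) * m.factorial := by
    have h1 : (1 : ℝ) ≤ m.factorial := by exact_mod_cast Nat.one_le_iff_ne_zero.2 m.factorial_ne_zero
    have h2 : (1 : ℝ) ≤ 2 ^ (m + 1) := one_le_pow₀ (by norm_num)
    nlinarith
  have hτ1 : 1 ≤ τ := hfac.trans hτ
  -- The cutoff radius is `e^l`. The majorant is `f₁` on the unit ball, where the symbol is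
  -- singular, and the tangent bound `f₂` on `1 < |ξ| ≤ e^l`; beyond that the symbol already exceeds
  -- `L`.
  set l : ℝ := τ / N with hl
  have hl0 : 0 ≤ l := by positivity
  set L : ℝ := (2 * l) ^ m with hL
  set K : ℝ := (4 / N : ℝ) ^ m * m.factorial with hK
  have hL0 : 0 ≤ L := by positivity
  have hK0 : 0 ≤ K := by positivity
  have hL' : (2 * τ / N) ^ m = L := by rw [hL, hl]; congr 1; ring
  set M : ℝ := m * (2 * l) ^ (m - 1) * 2 with hM
  have hM0 : 0 ≤ M := by positivity
  set f₁ : ℝ → ℝ := fun y => L + K * y ^ (-(N : ℝ) / 2) with hf₁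
  set f₂ : ℝ → ℝ := fun y => M * (l - log y) with hf₂
  obtain ⟨i1, e1⟩ := integrableOn_pow_mul_add_rpow hN L K
  have i2 : IntegrableOn (fun y : ℝ => y ^ (N - 1) * f₂ y) (Ioc 1 (exp l)) := by
    refine ((integrableOn_pow_mul_sub_log N l).const_mul M).congr ?_
    refine ae_of_all _ fun y => ?_
    simp only [hf₂]; ring
  have e2 : ∫ y in Ioc 1 (exp l), y ^ (N - 1) * f₂ y
      = M * ((exp (N * l) - 1 - N * l) / (N : ℝ) ^ 2) := by
    rw [← integral_pow_mul_sub_log hN hl0, ← integral_const_mul]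
    congr 1
    ext y
    simp only [hf₂]; ring
  obtain ⟨j1, k1⟩ := integral_indicator_norm hN (measurableSet_Iic (a := (1 : ℝ)))
    (t := Ioc 0 1) Ioi_inter_Iic i1
  obtain ⟨j2, k2⟩ := integral_indicator_norm hN (measurableSet_Ioc (a := (1 : ℝ)) (b := exp l))
    (t := Ioc 1 (exp l)) (inter_eq_right.2 fun y hy => lt_trans one_pos hy.1) i2
  have n1 : ∀ y, 0 ≤ y → 0 ≤ (Iic 1).indicator f₁ y := by
    intro y hy
    refine indicator_apply_nonneg fun _ => ?_
    have := rpow_nonneg hy (-(N : ℝ) / 2)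
    simp only [hf₁]; positivity
  have n2 : ∀ y, 0 ≤ (Ioc 1 (exp l)).indicator f₂ y := by
    intro y
    refine indicator_apply_nonneg fun hy => mul_nonneg hM0 ?_
    have := log_le_log (by linarith [hy.1]) hy.2
    rw [log_exp] at this
    linarith
  have small : ∀ y, 0 ≤ y → y ≤ 1 → L + |2 * log y| ^ m ≤ f₁ y := by
    intro y h0 h1
    simp only [hf₁]
    rcases h0.eq_or_lt with rfl | h0
    -- At the origin both `log 0` and `0 ^ (-N/2)` take the default value 0, so the inequality
    -- reduces to `L ≤ L`.
    · simp [show m ≠ 0 by omega, show (N : ℝ) ≠ 0 by positivity]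
    · gcongr
      exact abs_two_mul_log_pow_le hN m h0 h1
  refine ⟨fun ξ => (Iic 1).indicator f₁ ‖ξ‖ + (Ioc 1 (exp l)).indicator f₂ ‖ξ‖, j1.add j2,
    fun ξ => add_nonneg (n1 _ (norm_nonneg _)) (n2 _), ?_, ?_, ?_⟩
  · intro ξ
    rw [hL']
    beta_reduce
    set r := ‖ξ‖
    have hr0 : 0 ≤ r := norm_nonneg _
    rcases le_or_gt r 1 with h | h
    · have h1 := small r hr0 h
      have h2 : -(2 * log r) ^ m ≤ |2 * log r| ^ m := by
        rw [← abs_pow]; exact neg_le_abs _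
      rw [indicator_of_mem (show r ∈ Iic 1 from h)]
      linarith [n2 r]
    · have hlog : 0 < log r := log_pos h
      rcases le_or_gt r (exp l) with h' | h'
      · rw [indicator_of_mem (show r ∈ Ioc 1 (exp l) from ⟨h, h'⟩)]
        have := pow_sub_pow_le_mul_sub (a := 2 * l) (b := 2 * log r) (by positivity)
          (by linarith [(log_le_iff_le_exp (by linarith)).2 h']) m
        simp only [hf₂, hM]
        linarith [n1 r hr0]
      · have h3 : l ≤ log r := by
          rw [le_log_iff_exp_le (by linarith)]; exact h'.le
        have h4 : L ≤ (2 * log r) ^ m := by rw [hL]; gcongr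
        linarith [n1 r hr0, n2 r]
  · intro ξ h
    have h1 := small ‖ξ‖ (norm_nonneg _) h
    beta_reduce
    rw [indicator_of_mem (show ‖ξ‖ ∈ Iic 1 from h)]
    linarith [n2 ‖ξ‖]
  · have hs : 0 ≤ sphereVolume N := ENNReal.toReal_nonneg
    rw [integral_add j1 j2, k1, k2, e1, e2, ← mul_add]
    refine mul_le_mul_of_nonneg_left ?_ hs
    have hNl : (N : ℝ) * l = τ := by rw [hl]; field_simp
    obtain ⟨n, rfl⟩ : ∃ n, m = n + 1 := ⟨m - 1, by omega⟩
    have hn : (1 : ℝ) ≤ n := by exact_mod_cast (by omega : 1 ≤ n)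
    have key : L / N + 2 * K / N + M * ((exp (N * l) - 1 - N * l) / (N : ℝ) ^ 2)
        = 2 ^ (n + 1) / (N : ℝ) ^ (n + 1 + 1) * (τ ^ (n + 1) + 2 ^ (n + 1 + 1) * (n + 1).factorial
          + (n + 1) * (τ ^ n * (exp τ - 1 - τ))) := by
      rw [hNl, hL, hK, hM, hl]
      have h4 : (4 : ℝ) = 2 * 2 := by norm_num
      simp only [Nat.add_sub_cancel, h4, mul_pow, div_pow]
      push_cast
      field_simp
      ring
    rw [key]
    simp only [Nat.add_sub_cancel]
    push_cast
    -- The unit ball contributes `τ^m + 2^{m+1} m!`. It is absorbed by the terms `-1 - τ` in the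
    -- integral over the shell, because `2^{m+1} m! ≤ τ ≤ (m-1) τ^m`; this is where the threshold on
    -- `τ` and `m ≥ 2` enter.
    have h5 : 2 ^ (n + 1 + 1) * ((n + 1).factorial : ℝ) ≤ n * (τ ^ n * τ) := by
      have : (1 : ℝ) ≤ τ ^ n := one_le_pow₀ hτ1
      calc _ ≤ τ := hτ
        _ ≤ 1 * (1 * τ) := by simp
        _ ≤ _ := by gcongr
    have h6 : 0 ≤ (n + 1) * τ ^ n := by positivity
    calc _ ≤ 2 ^ (n + 1) / (N : ℝ) ^ (n + 1 + 1) * ((n + 1) * (τ ^ n * exp τ)) := by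
          gcongr
          rw [pow_succ τ n]
          nlinarith
      _ = _ := by ring

end LogWeight

end LogLaplacian

namespace LogLaplacian

open MeasureTheory FourierTransform SchwartzMap Real Set Filter Topology
open scoped ENNReal

/-! ### The energy space: linearity, Fatou's lemma and completeness. -/

section EnergySpace

theorem one_le_log_exp_one_add {r : ℝ} (hr : 0 ≤ r) : 1 ≤ log (exp 1 + r) := by
  rw [le_log_iff_exp_le (by positivity)]
  linarith

theorem measurable_weight {N : ℕ} (m : ℕ) :
    Measurable fun ξ : EuclideanSpace ℝ (Fin N) => log (exp 1 + ‖ξ‖) ^ m := by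
  fun_prop

/-- The weight grows at most polynomially, so Schwartz decay wins. Applied to transforms of test
functions, this shows that their energy is finite. -/
theorem integrable_weight_mul_norm_sq_schwartz {N : ℕ} (m : ℕ)
    (f : 𝓢(EuclideanSpace ℝ (Fin N), ℂ)) {c : ℝ} (hc : 0 < c) :
    Integrable fun ξ : EuclideanSpace ℝ (Fin N) => log (exp 1 + ‖ξ‖) ^ m * ‖f (c • ξ)‖ ^ 2 := by
  obtain ⟨B, hB⟩ : ∃ B, ∀ ξ, ‖f ξ‖ ≤ B :=
    ⟨_, fun ξ => by simpa using SchwartzMap.norm_le_seminorm ℝ f ξ⟩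
  have h0 := (integrable_comp_smul_iff volume _ hc.ne').2 (f.integrable_pow_mul volume 0)
  have h1 := (integrable_comp_smul_iff volume _ hc.ne').2 (f.integrable_pow_mul volume m)
  refine Integrable.mono' (g := fun ξ => 6 ^ m * B * (‖c • ξ‖ ^ 0 * ‖f (c • ξ)‖)
    + 6 ^ m * B / c ^ m * (‖c • ξ‖ ^ m * ‖f (c • ξ)‖)) ((h0.const_mul _).add (h1.const_mul _)) ?_ ?_
  · refine AEStronglyMeasurable.mul (measurable_weight m).aestronglyMeasurable ?_
    exact (((f.continuous.comp (continuous_const_smul c)).norm).pow 2).aestronglyMeasurable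
  · refine ae_of_all _ fun ξ => ?_
    have hB0 : 0 ≤ B := (norm_nonneg _).trans (hB 0)
    have hr := norm_nonneg ξ
    have hl := one_le_log_exp_one_add hr
    rw [norm_of_nonneg (by positivity), norm_smul, norm_of_nonneg hc.le, mul_pow c ‖ξ‖ m]
    have hw : log (exp 1 + ‖ξ‖) ^ m ≤ 6 ^ m * (1 + ‖ξ‖ ^ m) := by
      have e1 : exp 1 ≤ 3 := by linarith [exp_one_lt_d9]
      have e2 : log (exp 1 + ‖ξ‖) ≤ 6 * max 1 ‖ξ‖ := by
        have := log_le_sub_one_of_pos (show 0 < exp 1 + ‖ξ‖ by positivity)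
        have := le_max_left 1 ‖ξ‖
        have := le_max_right 1 ‖ξ‖
        linarith
      calc _ ≤ (6 * max 1 ‖ξ‖) ^ m := by gcongr
        _ = 6 ^ m * max 1 ‖ξ‖ ^ m := mul_pow _ _ _
        _ ≤ _ := by
          gcongr
          rcases max_choice 1 ‖ξ‖ with h | h <;> rw [h]
          · simp
          · linarith
    calc _ ≤ 6 ^ m * (1 + ‖ξ‖ ^ m) * (B * ‖f (c • ξ)‖) := by
          rw [pow_two]
          gcongr
          exact hB _
      _ = _ := by
        field_simp

variable {N : ℕ} {Ω : Set (EuclideanSpace ℝ (Fin N))}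

theorem IsTestFunction.memLp {φ : EuclideanSpace ℝ (Fin N) → ℝ} (h : IsTestFunction Ω φ) :
    MemLp φ 2 (volume.restrict Ω) :=
  (h.1.continuous.memLp_of_hasCompactSupport h.2.1).restrict Ω

variable (Ω) in
/-- The classes of test functions in `L²(Ω)`. -/
def testSpace : Submodule ℝ (L2 Ω) where
  carrier := {v | ∃ φ, IsTestFunction Ω φ ∧ v =ᵐ[volume.restrict Ω] φ}
  add_mem' := by
    rintro u v ⟨φ, h, hu⟩ ⟨ψ, h', hv⟩
    refine ⟨φ + ψ, ⟨h.1.add h'.1, h.2.1.add h'.2.1, ?_⟩, (Lp.coeFn_add u v).trans (hu.add hv)⟩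
    exact (tsupport_add φ ψ).trans (union_subset h.2.2 h'.2.2)
  zero_mem' := ⟨0, ⟨contDiff_const, HasCompactSupport.zero, by simp [tsupport]⟩, Lp.coeFn_zero _ _ _⟩
  smul_mem' := by
    rintro c u ⟨φ, h, hu⟩
    refine ⟨c • φ, ⟨h.1.const_smul c, h.2.1.smul_left (f := fun _ => c), ?_⟩,
      (Lp.coeFn_smul c u).trans (hu.const_smul c)⟩
    exact (tsupport_smul_subset_right (fun _ => c) φ).trans h.2.2

theorem normSq_congr (m : ℕ) {u v : EuclideanSpace ℝ (Fin N) → ℝ}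
    (h : u =ᵐ[volume.restrict Ω] v) : normSq m Ω u = normSq m Ω v := by
  simp only [normSq, hat_congr h]

/-- Replaces pointwise representatives by classes in `L²(Ω)`, so that the closure can be handled
with vector space operations. -/
theorem mem_energySpace_iff {m : ℕ} {u : L2 Ω} : u ∈ energySpace m Ω ↔
    ∀ ε : ℝ≥0∞, 0 < ε → ∃ v ∈ testSpace Ω, normSq m Ω (u - v : L2 Ω) < ε := by
  refine forall₂_congr fun ε _ => ⟨?_, ?_⟩
  · rintro ⟨φ, h, hε⟩
    refine ⟨h.memLp.toLp φ, ⟨φ, h, h.memLp.coeFn_toLp⟩, ?_⟩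
    rwa [normSq_congr m ((Lp.coeFn_sub _ _).trans (EventuallyEq.rfl.sub h.memLp.coeFn_toLp))]
  · rintro ⟨v, ⟨φ, h, hv⟩, hε⟩
    refine ⟨φ, h, ?_⟩
    rwa [normSq_congr m ((Lp.coeFn_sub _ _).trans (EventuallyEq.rfl.sub hv))] at hε

variable [IsFiniteMeasure ((volume : Measure (EuclideanSpace ℝ (Fin N))).restrict Ω)]

theorem measurable_normSq_integrand (hΩ : MeasurableSet Ω) (m : ℕ) (u : L2 Ω) :
    Measurable fun ξ => ENNReal.ofReal (log (exp 1 + ‖ξ‖) ^ m * ‖hat Ω u ξ‖ ^ 2) :=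
  ((measurable_weight m).mul ((continuous_hat hΩ u).norm.pow 2).measurable).ennreal_ofReal

theorem normSq_lt_top_iff (hΩ : MeasurableSet Ω) (m : ℕ) (u : L2 Ω) :
    normSq m Ω u < ∞ ↔ Integrable fun ξ => log (exp 1 + ‖ξ‖) ^ m * ‖hat Ω u ξ‖ ^ 2 := by
  have hnn : 0 ≤ᵐ[volume] fun ξ : EuclideanSpace ℝ (Fin N) =>
      log (exp 1 + ‖ξ‖) ^ m * ‖hat Ω u ξ‖ ^ 2 := ae_of_all _ fun ξ => by
    have := one_le_log_exp_one_add (norm_nonneg ξ)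
    positivity
  have hm := ((measurable_weight m).mul
    ((continuous_hat hΩ u).norm.pow 2).measurable).aestronglyMeasurable (μ := volume)
  refine ⟨fun h => ⟨hm, (hasFiniteIntegral_iff_ofReal hnn).2 h⟩,
    fun h => (hasFiniteIntegral_iff_ofReal hnn).1 h.2⟩

theorem normSq_add_le (hΩ : MeasurableSet Ω) (m : ℕ) (u v : L2 Ω) :
    normSq m Ω (u + v : L2 Ω) ≤ 2 * normSq m Ω u + 2 * normSq m Ω v := by
  unfold normSq
  rw [← lintegral_const_mul _ (measurable_normSq_integrand hΩ m u),
    ← lintegral_const_mul _ (measurable_normSq_integrand hΩ m v),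
    ← lintegral_add_left ((measurable_normSq_integrand hΩ m u).const_mul _)]
  refine lintegral_mono fun ξ => ?_
  have h1 := one_le_log_exp_one_add (norm_nonneg ξ)
  have h2 : ∀ x : ℝ, 2 * ENNReal.ofReal x = ENNReal.ofReal (2 * x) := fun x => by
    rw [ENNReal.ofReal_mul zero_le_two]; simp
  rw [h2, h2, ← ENNReal.ofReal_add (by positivity) (by positivity), hat_add]
  refine ENNReal.ofReal_le_ofReal ?_
  have h3 : ‖hat Ω u ξ + hat Ω v ξ‖ ^ 2 ≤ 2 * ‖hat Ω u ξ‖ ^ 2 + 2 * ‖hat Ω v ξ‖ ^ 2 := by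
    have := norm_add_le (hat Ω u ξ) (hat Ω v ξ)
    have := norm_nonneg (hat Ω u ξ + hat Ω v ξ)
    nlinarith [sq_nonneg (‖hat Ω u ξ‖ - ‖hat Ω v ξ‖)]
  calc _ ≤ log (exp 1 + ‖ξ‖) ^ m * (2 * ‖hat Ω u ξ‖ ^ 2 + 2 * ‖hat Ω v ξ‖ ^ 2) := by gcongr
    _ = _ := by ring

theorem normSq_smul (hΩ : MeasurableSet Ω) (m : ℕ) (c : ℝ) (u : L2 Ω) :
    normSq m Ω (c • u : L2 Ω) = ENNReal.ofReal (c ^ 2) * normSq m Ω u := by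
  unfold normSq
  rw [← lintegral_const_mul _ (measurable_normSq_integrand hΩ m u)]
  congr 1
  ext ξ
  rw [← ENNReal.ofReal_mul (sq_nonneg c), hat_smul, norm_mul, mul_pow]
  congr 1
  simp
  ring

theorem normSq_lt_top_of_mem_testSpace (hΩ : MeasurableSet Ω) (m : ℕ) {v : L2 Ω}
    (hv : v ∈ testSpace Ω) : normSq m Ω v < ∞ := by
  obtain ⟨φ, h, hφ⟩ := hv
  rw [normSq_lt_top_iff hΩ, hat_congr hφ]
  simp_rw [hat_eq_fourier hΩ]
  have hc : HasCompactSupport (fun x => (φ x : ℂ)) := h.2.1.comp_left (g := Complex.ofReal) (by simp)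
  have hd : ContDiff ℝ ((⊤ : ℕ∞) : WithTop ℕ∞) (fun x => (φ x : ℂ)) :=
    Complex.ofRealCLM.contDiff.comp h.1
  have e : (Ω.indicator fun x => (φ x : ℂ)) = (hc.toSchwartzMap hd : EuclideanSpace ℝ (Fin N) → ℂ) := by
    rw [indicator_eq_self.2]
    · rfl
    · intro x hx
      refine h.2.2 (subset_tsupport _ ?_)
      simpa using hx
  rw [e]
  exact integrable_weight_mul_norm_sq_schwartz m (𝓕 (hc.toSchwartzMap hd)) (by positivity)

/-- The energy space as a linear subspace of `L²(Ω)`. -/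
def energySubmodule (hΩ : MeasurableSet Ω) (m : ℕ) : Submodule ℝ (L2 Ω) where
  carrier := energySpace m Ω
  add_mem' := by
    intro u v hu hv
    rw [mem_energySpace_iff] at *
    intro ε hε
    have hε' : 0 < ε / 4 := ENNReal.div_pos hε.ne' (by norm_num)
    obtain ⟨a, ha, ha'⟩ := hu _ hε'
    obtain ⟨b, hb, hb'⟩ := hv _ hε'
    refine ⟨a + b, add_mem ha hb, ?_⟩
    rw [add_sub_add_comm]
    calc _ ≤ _ := normSq_add_le hΩ m _ _
      _ < 2 * (ε / 4) + 2 * (ε / 4) := by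
        gcongr <;> norm_num
      _ = ε := by
        rw [← two_mul, ← mul_assoc, show (2 : ℝ≥0∞) * 2 = 4 by norm_num]
        exact ENNReal.mul_div_cancel (by norm_num) (by norm_num)
  zero_mem' := by
    rw [mem_energySpace_iff]
    intro ε hε
    refine ⟨0, zero_mem _, ?_⟩
    rw [sub_zero, ← zero_smul ℝ (0 : L2 Ω), normSq_smul hΩ]
    simpa using hε
  smul_mem' := by
    intro c u hu
    rw [mem_energySpace_iff] at *
    intro ε hε
    obtain ⟨a, ha, ha'⟩ := hu (ε / (ENNReal.ofReal (c ^ 2) + 1))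
      (ENNReal.div_pos hε.ne' (by simp))
    refine ⟨c • a, Submodule.smul_mem _ c ha, ?_⟩
    rw [← smul_sub, normSq_smul hΩ]
    rcases eq_or_ne ε ∞ with rfl | hε'
    · refine ENNReal.mul_lt_top (by simp) (ha'.trans_le le_top)
    calc _ ≤ (ENNReal.ofReal (c ^ 2) + 1) * normSq m Ω (u - a : L2 Ω) := by gcongr; simp
      _ < (ENNReal.ofReal (c ^ 2) + 1) * (ε / (ENNReal.ofReal (c ^ 2) + 1)) := by
        rw [ENNReal.mul_lt_mul_iff_right (by simp) (by simp)]
        exact ha'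
      _ = ε := ENNReal.mul_div_cancel (by simp) (by simp)

theorem mem_energySubmodule {hΩ : MeasurableSet Ω} {m : ℕ} {u : L2 Ω} :
    u ∈ energySubmodule hΩ m ↔ u ∈ energySpace m Ω := Iff.rfl

theorem testSpace_le_energySubmodule (hΩ : MeasurableSet Ω) (m : ℕ) :
    testSpace Ω ≤ energySubmodule hΩ m := by
  intro u hu
  rw [mem_energySubmodule, mem_energySpace_iff]
  intro ε hε
  refine ⟨u, hu, ?_⟩
  rw [sub_self, ← zero_smul ℝ (0 : L2 Ω), normSq_smul hΩ]
  simpa using hε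

theorem normSq_lt_top_of_mem (hΩ : MeasurableSet Ω) {m : ℕ} {u : L2 Ω}
    (hu : u ∈ energySpace m Ω) : normSq m Ω u < ∞ := by
  obtain ⟨v, hv, h⟩ := mem_energySpace_iff.1 hu 1 one_pos
  have := normSq_add_le hΩ m (u - v) v
  rw [sub_add_cancel] at this
  refine this.trans_lt (ENNReal.add_lt_top.2 ⟨?_, ?_⟩)
  · exact ENNReal.mul_lt_top (by simp) (h.trans ENNReal.one_lt_top)
  · exact ENNReal.mul_lt_top (by simp) (normSq_lt_top_of_mem_testSpace hΩ m hv)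

/-- Fatou's lemma for the energy norm. -/
theorem normSq_le_of_tendsto (hΩ : MeasurableSet Ω) {m : ℕ} {u : ℕ → L2 Ω} {v : L2 Ω} {M : ℝ≥0∞}
    (h : ∀ w : L2 Ω, Tendsto (fun n => (inner ℝ w (u n) : ℝ)) atTop (𝓝 (inner ℝ w v)))
    (hM : ∀ᶠ n in atTop, normSq m Ω (u n) ≤ M) : normSq m Ω v ≤ M := by
  have key : normSq m Ω v ≤ liminf (fun n => normSq m Ω (u n)) atTop := by
    unfold normSq
    refine le_trans (le_of_eq ?_) (lintegral_liminf_le fun n => measurable_normSq_integrand hΩ m (u n))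
    congr 1
    ext ξ
    refine (Tendsto.liminf_eq ?_).symm
    exact (ENNReal.continuous_ofReal.tendsto _).comp
      (((continuous_norm.pow 2).tendsto _ |>.comp (tendsto_hat h ξ)).const_mul _)
  exact key.trans (liminf_le_of_frequently_le' hM.frequently)

omit [IsFiniteMeasure ((volume : Measure (EuclideanSpace ℝ (Fin N))).restrict Ω)] in
theorem tendsto_inner_of_tendsto {u : ℕ → L2 Ω} {v : L2 Ω} (h : Tendsto u atTop (𝓝 v)) (w : L2 Ω) :
    Tendsto (fun n => (inner ℝ w (u n) : ℝ)) atTop (𝓝 (inner ℝ w v)) :=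
  tendsto_const_nhds.inner h

/-- Completeness of the energy space. -/
theorem mem_energySpace_of_cauchy (hΩ : MeasurableSet Ω) {m : ℕ} {u : ℕ → L2 Ω} {v : L2 Ω}
    (hu : ∀ n, u n ∈ energySpace m Ω) (h : Tendsto u atTop (𝓝 v))
    (hc : ∀ ε : ℝ≥0∞, 0 < ε → ∃ n₀, ∀ n ≥ n₀, ∀ k ≥ n₀, normSq m Ω (u n - u k : L2 Ω) ≤ ε) :
    v ∈ energySpace m Ω ∧ Tendsto (fun n => normSq m Ω (u n - v : L2 Ω)) atTop (𝓝 0) := by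
  have h1 : Tendsto (fun n => normSq m Ω (u n - v : L2 Ω)) atTop (𝓝 0) := by
    rw [ENNReal.tendsto_nhds_zero]
    intro ε hε
    obtain ⟨n₀, hn₀⟩ := hc ε hε
    filter_upwards [eventually_ge_atTop n₀] with n hn
    -- Fix `n` and let `k → ∞` in the Cauchy estimate, using lower semicontinuity of the energy.
    exact normSq_le_of_tendsto hΩ (u := fun k => u n - u k)
      (tendsto_inner_of_tendsto (tendsto_const_nhds.sub h))
      ((eventually_ge_atTop n₀).mono fun k hk => hn₀ n hn k hk)
  refine ⟨?_, h1⟩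
  rw [mem_energySpace_iff]
  intro ε hε
  have hε' : 0 < ε / 4 := ENNReal.div_pos hε.ne' (by norm_num)
  obtain ⟨n, hn⟩ := (h1.eventually_lt_const hε').exists
  obtain ⟨w, hw, hw'⟩ := mem_energySpace_iff.1 (hu n) _ hε'
  refine ⟨w, hw, ?_⟩
  have e : v - w = (-1 : ℝ) • (u n - v) + (u n - w) := by
    rw [neg_one_smul]; abel
  rw [e]
  calc _ ≤ _ := normSq_add_le hΩ m _ _
    _ < 2 * (ε / 4) + 2 * (ε / 4) := by
      rw [normSq_smul hΩ]
      gcongr <;> norm_num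
      exact hn
    _ = ε := by
      rw [← two_mul, ← mul_assoc, show (2 : ℝ≥0∞) * 2 = 4 by norm_num]
      exact ENNReal.mul_div_cancel (by norm_num) (by norm_num)

end EnergySpace

end LogLaplacian

namespace LogLaplacian

open MeasureTheory FourierTransform SchwartzMap Real Set Filter Topology
open scoped ENNReal

/-! ### The bilinear form and Gårding's inequality. -/

section Form

variable {N : ℕ} {Ω : Set (EuclideanSpace ℝ (Fin N))}

theorem two_mul_log_pow_le_weight (m : ℕ) {r : ℝ} (hr : 1 ≤ r) :
    |(2 * log r) ^ m| ≤ 2 ^ m * log (exp 1 + r) ^ m := by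
  have h0 : 0 ≤ log r := log_nonneg hr
  rw [abs_of_nonneg (by positivity), mul_pow]
  gcongr
  linarith [exp_pos 1]

/-- Comparison of the symbol of the logarithmic Laplacian with the energy weight. -/
theorem exists_symbol_bounds (hN : 1 ≤ N) {m : ℕ} (hm : 2 ≤ m) :
    ∃ D : EuclideanSpace ℝ (Fin N) → ℝ, Integrable D ∧ (∀ ξ, 0 ≤ D ξ) ∧
      (∀ ξ, |(2 * log ‖ξ‖) ^ m| ≤ 2 ^ m * log (exp 1 + ‖ξ‖) ^ m + D ξ) ∧
      ∀ ξ, log (exp 1 + ‖ξ‖) ^ m ≤ (2 * log ‖ξ‖) ^ m + D ξ := by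
  -- Only the bound for the singularity in the unit ball is used here, so the smallest admissible
  -- `τ` will do. Radius 3 below is chosen so that `e + r ≤ r²` outside the ball, while `e + r ≤ e²`
  -- inside.
  obtain ⟨g, hg, hg0, -, hg1, -⟩ := exists_log_defect hN hm le_rfl
  have hb : Integrable ((Metric.closedBall (0 : EuclideanSpace ℝ (Fin N)) 3).indicator
      fun _ => (2 : ℝ) ^ m) := by
    rw [integrable_indicator_iff Metric.isClosed_closedBall.measurableSet]
    exact integrableOn_const (measure_closedBall_lt_top.ne)
  have hb0 : ∀ ξ, 0 ≤ (Metric.closedBall (0 : EuclideanSpace ℝ (Fin N)) 3).indicator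
      (fun _ => (2 : ℝ) ^ m) ξ := fun ξ => indicator_apply_nonneg fun _ => by positivity
  refine ⟨_, hb.add hg, fun ξ => add_nonneg (hb0 ξ) (hg0 ξ), ?_, ?_⟩
  · intro ξ
    simp only [Pi.add_apply]
    have hw : 0 ≤ 2 ^ m * log (exp 1 + ‖ξ‖) ^ m := by
      have := one_le_log_exp_one_add (norm_nonneg ξ)
      positivity
    rcases le_total ‖ξ‖ 1 with h | h
    · have := hg1 ξ h
      rw [← abs_pow] at this
      linarith [hb0 ξ]
    · linarith [two_mul_log_pow_le_weight m h, hb0 ξ, hg0 ξ]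
  · intro ξ
    simp only [Pi.add_apply]
    have hl := one_le_log_exp_one_add (norm_nonneg ξ)
    rcases le_total ‖ξ‖ 3 with h | h
    · have hw : log (exp 1 + ‖ξ‖) ^ m ≤ 2 ^ m := by
        gcongr
        rw [log_le_iff_le_exp (by positivity)]
        have h2 : exp 2 = exp 1 * exp 1 := by rw [← exp_add]; norm_num
        have := exp_one_gt_d9
        nlinarith
      rw [indicator_of_mem (by simpa using h)]
      have : 0 ≤ (2 * log ‖ξ‖) ^ m + g ξ := by
        rcases le_total ‖ξ‖ 1 with h' | h'
        · have := hg1 ξ h'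
          rw [← abs_pow] at this
          linarith [neg_abs_le ((2 * log ‖ξ‖) ^ m)]
        · have := log_nonneg h'
          have := hg0 ξ
          positivity
      linarith
    · have : log (exp 1 + ‖ξ‖) ≤ 2 * log ‖ξ‖ := by
        have e : 2 * log ‖ξ‖ = log (‖ξ‖ ^ 2) := by rw [log_pow]; norm_num
        rw [e]
        refine log_le_log (by positivity) ?_
        nlinarith [exp_one_lt_d9]
      have : log (exp 1 + ‖ξ‖) ^ m ≤ (2 * log ‖ξ‖) ^ m := by gcongr
      linarith [hb0 ξ, hg0 ξ]

theorem re_mul_conj_self (z : ℂ) : (z * (starRingEnd ℂ) z).re = ‖z‖ ^ 2 := by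
  rw [Complex.mul_conj, Complex.ofReal_re, Complex.normSq_eq_norm_sq]

theorem abs_re_mul_conj_le (z w : ℂ) : |(z * (starRingEnd ℂ) w).re| ≤ ‖z‖ ^ 2 + ‖w‖ ^ 2 := by
  refine (Complex.abs_re_le_norm _).trans ?_
  rw [norm_mul, RCLike.norm_conj]
  nlinarith [sq_nonneg (‖z‖ - ‖w‖), sq_nonneg (‖z‖ + ‖w‖)]

theorem measurable_symbol (m : ℕ) :
    Measurable fun ξ : EuclideanSpace ℝ (Fin N) => (2 * log ‖ξ‖) ^ m := by
  fun_prop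

variable [IsFiniteMeasure ((volume : Measure (EuclideanSpace ℝ (Fin N))).restrict Ω)]

theorem integrable_mul_norm_sq_hat (hΩ : MeasurableSet Ω) {D : EuclideanSpace ℝ (Fin N) → ℝ}
    (hD : Integrable D) (u : L2 Ω) : Integrable fun ξ => D ξ * ‖hat Ω u ξ‖ ^ 2 := by
  refine hD.mul_bdd (c := vol Ω * ‖u‖ ^ 2) ((continuous_hat hΩ u).norm.pow 2).aestronglyMeasurable
    (ae_of_all _ fun ξ => ?_)
  rw [norm_of_nonneg (by positivity)]
  exact norm_sq_hat_le u ξ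

theorem integral_mul_norm_sq_hat_le (hΩ : MeasurableSet Ω) {D : EuclideanSpace ℝ (Fin N) → ℝ}
    (hD : Integrable D) (hD0 : ∀ ξ, 0 ≤ D ξ) (u : L2 Ω) :
    ∫ ξ, D ξ * ‖hat Ω u ξ‖ ^ 2 ≤ vol Ω * (∫ ξ, D ξ) * ‖u‖ ^ 2 := by
  calc _ ≤ ∫ ξ, D ξ * (vol Ω * ‖u‖ ^ 2) :=
        integral_mono (integrable_mul_norm_sq_hat hΩ hD u) (hD.mul_const _)
          fun ξ => mul_le_mul_of_nonneg_left (norm_sq_hat_le u ξ) (hD0 ξ)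
    _ = _ := by rw [integral_mul_const]; ring

theorem integrable_symbol_mul_norm_sq (hΩ : MeasurableSet Ω) (hN : 1 ≤ N) {m : ℕ} (hm : 2 ≤ m)
    {u : L2 Ω} (hu : u ∈ energySpace m Ω) :
    Integrable fun ξ => (2 * log ‖ξ‖) ^ m * ‖hat Ω u ξ‖ ^ 2 := by
  obtain ⟨D, hD, hD0, h1, -⟩ := exists_symbol_bounds hN hm
  have hw := (normSq_lt_top_iff hΩ m u).1 (normSq_lt_top_of_mem hΩ hu)
  refine ((hw.const_mul (2 ^ m)).add (integrable_mul_norm_sq_hat hΩ hD u)).mono'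
    ((measurable_symbol m).mul
      ((continuous_hat hΩ u).norm.pow 2).measurable).aestronglyMeasurable (ae_of_all _ fun ξ => ?_)
  rw [norm_mul, norm_of_nonneg (sq_nonneg ‖hat Ω u ξ‖), Real.norm_eq_abs]
  calc _ ≤ _ := mul_le_mul_of_nonneg_right (h1 ξ) (sq_nonneg _)
    _ = _ := by simp only [Pi.add_apply]; ring

theorem integrable_form_integrand (hΩ : MeasurableSet Ω) (hN : 1 ≤ N) {m : ℕ} (hm : 2 ≤ m)
    {u v : L2 Ω} (hu : u ∈ energySpace m Ω) (hv : v ∈ energySpace m Ω) :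
    Integrable fun ξ => (2 * log ‖ξ‖) ^ m * (hat Ω u ξ * (starRingEnd ℂ) (hat Ω v ξ)).re := by
  refine ((integrable_symbol_mul_norm_sq hΩ hN hm hu).norm.add
    (integrable_symbol_mul_norm_sq hΩ hN hm hv).norm).mono'
    ((measurable_symbol m).mul ?_).aestronglyMeasurable (ae_of_all _ fun ξ => ?_)
  · exact (Complex.continuous_re.comp ((continuous_hat hΩ u).mul
      (Complex.continuous_conj.comp (continuous_hat hΩ v)))).measurable
  · simp only [norm_mul, Pi.add_apply, norm_pow, norm_norm]
    rw [← mul_add]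
    gcongr
    exact abs_re_mul_conj_le _ _

/-- The form of the logarithmic Laplacian as a bilinear form on the energy space. -/
noncomputable def formBilin (hΩ : MeasurableSet Ω) (hN : 1 ≤ N) {m : ℕ} (hm : 2 ≤ m) :
    energySubmodule hΩ m →ₗ[ℝ] energySubmodule hΩ m →ₗ[ℝ] ℝ :=
  LinearMap.mk₂ ℝ (fun u v => form m Ω u v)
    (fun u u' v => by
      simp only [form]
      rw [← mul_add, ← integral_add (integrable_form_integrand hΩ hN hm u.2 v.2)
        (integrable_form_integrand hΩ hN hm u'.2 v.2)]
      congr 2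
      ext ξ
      rw [Submodule.coe_add, hat_add, add_mul, Complex.add_re, mul_add])
    (fun c u v => by
      simp only [form, smul_eq_mul]
      rw [mul_left_comm, ← integral_const_mul c]
      congr 2
      ext ξ
      rw [Submodule.coe_smul, hat_smul, mul_assoc, Complex.re_ofReal_mul]
      ring)
    (fun u v v' => by
      simp only [form]
      rw [← mul_add, ← integral_add (integrable_form_integrand hΩ hN hm u.2 v.2)
        (integrable_form_integrand hΩ hN hm u.2 v'.2)]
      congr 2
      ext ξ
      rw [Submodule.coe_add, hat_add, map_add, mul_add, Complex.add_re, mul_add])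
    (fun c u v => by
      simp only [form, smul_eq_mul]
      rw [mul_left_comm, ← integral_const_mul c]
      congr 2
      ext ξ
      rw [Submodule.coe_smul, hat_smul, map_mul, Complex.conj_ofReal, mul_left_comm,
        Complex.re_ofReal_mul]
      ring)

theorem formBilin_apply (hΩ : MeasurableSet Ω) (hN : 1 ≤ N) {m : ℕ} (hm : 2 ≤ m)
    (u v : energySubmodule hΩ m) : formBilin hΩ hN hm u v = form m Ω u v := rfl

omit [IsFiniteMeasure ((volume : Measure (EuclideanSpace ℝ (Fin N))).restrict Ω)] in
theorem form_comm (m : ℕ) (u v : L2 Ω) : form m Ω u v = form m Ω v u := by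
  simp only [form]
  congr 2
  ext ξ
  congr 1
  rw [← Complex.conj_re, map_mul, Complex.conj_conj, mul_comm]

omit [IsFiniteMeasure ((volume : Measure (EuclideanSpace ℝ (Fin N))).restrict Ω)] in
theorem form_self (m : ℕ) (u : L2 Ω) :
    (2 * π) ^ N * form m Ω u u = ∫ ξ, (2 * log ‖ξ‖) ^ m * ‖hat Ω u ξ‖ ^ 2 := by
  rw [form, ← mul_assoc, mul_inv_cancel₀ (by positivity), one_mul]
  simp_rw [re_mul_conj_self]

theorem normSq_eq_ofReal (hΩ : MeasurableSet Ω) {m : ℕ} {u : L2 Ω} (hu : u ∈ energySpace m Ω) :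
    normSq m Ω u = ENNReal.ofReal (∫ ξ, log (exp 1 + ‖ξ‖) ^ m * ‖hat Ω u ξ‖ ^ 2) := by
  rw [ofReal_integral_eq_lintegral_ofReal
    ((normSq_lt_top_iff hΩ m u).1 (normSq_lt_top_of_mem hΩ hu))]
  · rfl
  · refine ae_of_all _ fun ξ => ?_
    have := one_le_log_exp_one_add (norm_nonneg ξ)
    simp only [Pi.zero_apply]
    positivity

/-- Gårding's inequality and boundedness of the form in the energy norm. -/
theorem exists_garding (hΩ : MeasurableSet Ω) (hN : 1 ≤ N) {m : ℕ} (hm : 2 ≤ m) :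
    ∃ C : ℝ, 0 ≤ C ∧ ∀ u ∈ energySpace m Ω,
      (normSq m Ω u).toReal ≤ (2 * π) ^ N * (form m Ω u u + C * ‖u‖ ^ 2) ∧
      (2 * π) ^ N * (form m Ω u u + C * ‖u‖ ^ 2)
        ≤ 2 ^ m * (normSq m Ω u).toReal + 2 * (2 * π) ^ N * C * ‖u‖ ^ 2 := by
  obtain ⟨D, hD, hD0, h1, h2⟩ := exists_symbol_bounds hN hm
  have hP : (0 : ℝ) < (2 * π) ^ N := by positivity
  have hI : 0 ≤ vol Ω * ∫ ξ, D ξ := mul_nonneg ENNReal.toReal_nonneg (integral_nonneg hD0)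
  -- The error weight `D` is integrable and `|û|² ≤ |Ω| ‖u‖²` pointwise, so its total contribution
  -- is a multiple of the `L²` norm squared.
  refine ⟨((2 * π) ^ N)⁻¹ * (vol Ω * ∫ ξ, D ξ), by positivity, fun u hu => ?_⟩
  have iw := (normSq_lt_top_iff hΩ m u).1 (normSq_lt_top_of_mem hΩ hu)
  have is := integrable_symbol_mul_norm_sq hΩ hN hm hu
  have iD := integrable_mul_norm_sq_hat hΩ hD u
  have hn : (normSq m Ω u).toReal = ∫ ξ, log (exp 1 + ‖ξ‖) ^ m * ‖hat Ω u ξ‖ ^ 2 := by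
    rw [normSq_eq_ofReal hΩ hu, ENNReal.toReal_ofReal]
    refine integral_nonneg fun ξ => ?_
    have := one_le_log_exp_one_add (norm_nonneg ξ)
    simp only [Pi.zero_apply]
    positivity
  have hle := integral_mul_norm_sq_hat_le hΩ hD hD0 u
  have e : (2 * π) ^ N * (form m Ω u u + ((2 * π) ^ N)⁻¹ * (vol Ω * ∫ ξ, D ξ) * ‖u‖ ^ 2)
      = (∫ ξ, (2 * log ‖ξ‖) ^ m * ‖hat Ω u ξ‖ ^ 2) + vol Ω * (∫ ξ, D ξ) * ‖u‖ ^ 2 := by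
    rw [mul_add, form_self]
    field_simp
  have e' : 2 * (2 * π) ^ N * (((2 * π) ^ N)⁻¹ * (vol Ω * ∫ ξ, D ξ)) * ‖u‖ ^ 2
      = 2 * (vol Ω * (∫ ξ, D ξ) * ‖u‖ ^ 2) := by
    field_simp
  rw [e, e', hn]
  constructor
  · calc _ ≤ ∫ ξ, ((2 * log ‖ξ‖) ^ m * ‖hat Ω u ξ‖ ^ 2 + D ξ * ‖hat Ω u ξ‖ ^ 2) := by
          refine integral_mono iw (is.add iD) fun ξ => ?_
          simp only [← add_mul]
          exact mul_le_mul_of_nonneg_right (h2 ξ) (sq_nonneg _)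
      _ ≤ _ := by
          rw [integral_add is iD]
          gcongr
  · have : ∫ ξ, (2 * log ‖ξ‖) ^ m * ‖hat Ω u ξ‖ ^ 2 ≤
        ∫ ξ, (2 ^ m * (log (exp 1 + ‖ξ‖) ^ m * ‖hat Ω u ξ‖ ^ 2) + D ξ * ‖hat Ω u ξ‖ ^ 2) := by
      refine integral_mono is ((iw.const_mul _).add iD) fun ξ => ?_
      simp only [← mul_assoc, ← add_mul]
      exact mul_le_mul_of_nonneg_right ((le_abs_self _).trans (h1 ξ)) (sq_nonneg _)
    rw [integral_add (iw.const_mul _) iD, integral_const_mul] at this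
    linarith

end Form

/-! ### Compact embedding of the energy space into `L²(Ω)`. -/

section Compactness

variable {N : ℕ} {Ω : Set (EuclideanSpace ℝ (Fin N))}
  [IsFiniteMeasure ((volume : Measure (EuclideanSpace ℝ (Fin N))).restrict Ω)]

omit [IsFiniteMeasure ((volume : Measure (EuclideanSpace ℝ (Fin N))).restrict Ω)] in
-- Outside the ball of radius `e^s` the energy weight is at least `s`. High frequencies are
-- therefore uniformly small on sets of bounded energy.
theorem norm_sq_hat_le_indicator_add {m : ℕ} (hm : m ≠ 0) {s : ℝ} (hs : 1 ≤ s) (u : L2 Ω)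
    (ξ : EuclideanSpace ℝ (Fin N)) :
    ‖hat Ω u ξ‖ ^ 2 ≤ (Metric.closedBall 0 (exp s)).indicator (fun ξ => ‖hat Ω u ξ‖ ^ 2) ξ
      + s⁻¹ * (log (exp 1 + ‖ξ‖) ^ m * ‖hat Ω u ξ‖ ^ 2) := by
  have hl := one_le_log_exp_one_add (norm_nonneg ξ)
  have h0 : 0 ≤ s⁻¹ * (log (exp 1 + ‖ξ‖) ^ m * ‖hat Ω u ξ‖ ^ 2) := by positivity
  by_cases h : ξ ∈ Metric.closedBall 0 (exp s)
  · rw [indicator_of_mem h]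
    linarith
  · rw [indicator_of_notMem h, zero_add, ← mul_assoc]
    refine le_mul_of_one_le_left (sq_nonneg _) ?_
    rw [inv_mul_eq_div, one_le_div (by linarith)]
    have h1 : exp s ≤ ‖ξ‖ := by
      rw [Metric.mem_closedBall, dist_zero_right, not_le] at h
      exact h.le
    calc s ≤ log (exp 1 + ‖ξ‖) := by
          rw [le_log_iff_exp_le (by positivity)]
          linarith [exp_pos 1]
      _ ≤ _ := le_self_pow₀ hl hm

/-- Weakly convergent sequences that are bounded in the energy norm converge strongly. -/
theorem tendsto_of_weak_of_normSq_le (hΩ : MeasurableSet Ω) {m : ℕ} (hm : m ≠ 0) {u : ℕ → L2 Ω}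
    {v : L2 Ω} {M : ℝ≥0∞} (hM : M < ∞) {B : ℝ} (hB : ∀ n, ‖u n‖ ≤ B)
    (h : ∀ w : L2 Ω, Tendsto (fun n => (inner ℝ w (u n) : ℝ)) atTop (𝓝 (inner ℝ w v)))
    (hu : ∀ n, normSq m Ω (u n) ≤ M) : Tendsto u atTop (𝓝 v) := by
  have hv : normSq m Ω v ≤ M := normSq_le_of_tendsto hΩ h (Eventually.of_forall hu)
  have hd : ∀ n, normSq m Ω (u n - v : L2 Ω) ≤ 4 * M := by
    intro n
    have e : u n - v = u n + (-1 : ℝ) • v := by rw [neg_one_smul, sub_eq_add_neg]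
    rw [e]
    refine (normSq_add_le hΩ m _ _).trans ?_
    rw [normSq_smul hΩ]
    calc _ ≤ 2 * M + 2 * M := by
          gcongr
          · exact hu n
          · simpa using hv
      _ = 4 * M := by rw [← add_mul]; norm_num
  have hM4 : 4 * M < ∞ := ENNReal.mul_lt_top (by simp) hM
  have hint : ∀ n, Integrable fun ξ => log (exp 1 + ‖ξ‖) ^ m * ‖hat Ω (u n - v : L2 Ω) ξ‖ ^ 2 :=
    fun n => (normSq_lt_top_iff hΩ m _).1 ((hd n).trans_lt hM4)
  have hint' : ∀ n, ∫ ξ, log (exp 1 + ‖ξ‖) ^ m * ‖hat Ω (u n - v : L2 Ω) ξ‖ ^ 2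
      ≤ (4 * M).toReal := by
    intro n
    rw [integral_eq_lintegral_of_nonneg_ae _ (hint n).1]
    · exact ENNReal.toReal_mono hM4.ne (hd n)
    · refine ae_of_all _ fun ξ => ?_
      have := one_le_log_exp_one_add (norm_nonneg ξ)
      simp only [Pi.zero_apply]
      positivity
  have hP : (0 : ℝ) < (2 * π) ^ N := by positivity
  -- Weak convergence makes `û_n` converge pointwise, and the uniform bound on `û_n` permits
  -- dominated convergence on a ball. The frequencies outside it are handled by the energy bound.
  have low : ∀ s : ℝ, Tendsto (fun n => ∫ ξ,
      (Metric.closedBall 0 (exp s)).indicator (fun ξ => ‖hat Ω (u n - v : L2 Ω) ξ‖ ^ 2) ξ)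
      atTop (𝓝 0) := by
    intro s
    have hball : MeasurableSet (Metric.closedBall (0 : EuclideanSpace ℝ (Fin N)) (exp s)) :=
      Metric.isClosed_closedBall.measurableSet
    simp_rw [integral_indicator hball]
    rw [← integral_zero (EuclideanSpace ℝ (Fin N)) ℝ
      (μ := volume.restrict (Metric.closedBall 0 (exp s)))]
    refine tendsto_integral_of_dominated_convergence (fun _ => vol Ω * (B + ‖v‖) ^ 2)
      (fun n => ((continuous_hat hΩ _).norm.pow 2).aestronglyMeasurable)
      (integrableOn_const measure_closedBall_lt_top.ne) (fun n => ae_of_all _ fun ξ => ?_)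
      (ae_of_all _ fun ξ => ?_)
    · rw [norm_of_nonneg (by positivity)]
      refine (norm_sq_hat_le _ _).trans ?_
      have := ENNReal.toReal_nonneg (a := volume Ω)
      have h2 : ‖u n - v‖ ≤ B + ‖v‖ := (norm_sub_le _ _).trans (by gcongr; exact hB n)
      rw [vol]
      gcongr
    · have := ((tendsto_hat h ξ).sub_const (hat Ω v ξ)).norm.pow 2
      simp_rw [hat_sub]
      simpa using this
  have key : Tendsto (fun n => ‖u n - v‖ ^ 2) atTop (𝓝 0) := by
    refine tendsto_order.2 ⟨fun a ha => Eventually.of_forall fun n => ha.trans_le (sq_nonneg _),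
      fun ε hε => ?_⟩
    obtain ⟨s, hs1, hs⟩ : ∃ s : ℝ, 1 ≤ s ∧ s⁻¹ * (4 * M).toReal < (2 * π) ^ N * ε / 2 := by
      have : Tendsto (fun s : ℝ => s⁻¹ * (4 * M).toReal) atTop (𝓝 (0 * (4 * M).toReal)) :=
        tendsto_inv_atTop_zero.mul_const _
      rw [zero_mul] at this
      obtain ⟨s, h1, h2⟩ := ((this.eventually_lt_const (by positivity :
        0 < (2 * π) ^ N * ε / 2)).and (eventually_ge_atTop 1)).exists
      exact ⟨s, h2, h1⟩
    filter_upwards [(low s).eventually_lt_const (by positivity :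
        0 < (2 * π) ^ N * ε / 2)] with n hn
    have iI : Integrable fun ξ => (Metric.closedBall 0 (exp s)).indicator
        (fun ξ => ‖hat Ω (u n - v : L2 Ω) ξ‖ ^ 2) ξ :=
      (integrable_norm_sq_hat hΩ _).indicator Metric.isClosed_closedBall.measurableSet
    have h1 := integral_mono (integrable_norm_sq_hat hΩ (u n - v)) (iI.add ((hint n).const_mul s⁻¹))
      (norm_sq_hat_le_indicator_add hm hs1 (u n - v))
    simp only [Pi.add_apply] at h1
    rw [integral_norm_sq_hat hΩ, integral_add iI ((hint n).const_mul s⁻¹), integral_const_mul] at h1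
    have h2 : s⁻¹ * ∫ ξ, log (exp 1 + ‖ξ‖) ^ m * ‖hat Ω (u n - v : L2 Ω) ξ‖ ^ 2
        ≤ s⁻¹ * (4 * M).toReal := by
      gcongr
      exact hint' n
    have h3 : (2 * π) ^ N * ‖u n - v‖ ^ 2 < (2 * π) ^ N * ε := by linarith
    exact lt_of_mul_lt_mul_left h3 hP.le
  rw [tendsto_iff_norm_sub_tendsto_zero]
  have := key.sqrt
  simpa using this

/-- Sequential Banach–Alaoglu, carried from the dual to `H` by the Riesz isomorphism. -/
theorem exists_tendsto_weak {H : Type*} [NormedAddCommGroup H] [InnerProductSpace ℝ H]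
    [CompleteSpace H] [TopologicalSpace.SeparableSpace H] {u : ℕ → H} {B : ℝ}
    (hB : ∀ n, ‖u n‖ ≤ B) : ∃ (v : H) (φ : ℕ → ℕ), StrictMono φ ∧
      ∀ w : H, Tendsto (fun n => (inner ℝ w (u (φ n)) : ℝ)) atTop (𝓝 (inner ℝ w v)) := by
  have hc := WeakDual.isSeqCompact_closedBall ℝ H 0 B
  obtain ⟨a, -, φ, hφ, ha⟩ := hc (x := fun n =>
    StrongDual.toWeakDual (InnerProductSpace.toDual ℝ H (u n))) (fun n => by
      simpa using hB n)
  refine ⟨(InnerProductSpace.toDual ℝ H).symm (WeakDual.toStrongDual a), φ, hφ, fun w => ?_⟩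
  have := (WeakDual.eval_continuous w).tendsto a |>.comp ha
  have e : (inner ℝ w ((InnerProductSpace.toDual ℝ H).symm (WeakDual.toStrongDual a)) : ℝ)
      = a w := by
    rw [real_inner_comm]
    simp
  rw [e]
  refine this.congr fun n => ?_
  simp [real_inner_comm]

/-- The embedding of the energy space into `L²(Ω)` is compact. -/
theorem exists_subseq_tendsto (hΩ : MeasurableSet Ω) {m : ℕ} (hm : m ≠ 0) {u : ℕ → L2 Ω}
    {M : ℝ≥0∞} (hM : M < ∞) {B : ℝ} (hB : ∀ n, ‖u n‖ ≤ B) (hu : ∀ n, normSq m Ω (u n) ≤ M) :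
    ∃ (v : L2 Ω) (φ : ℕ → ℕ), StrictMono φ ∧ Tendsto (u ∘ φ) atTop (𝓝 v) := by
  -- Needed for the instance that makes `L²(Ω)` separable.
  have : Fact ((2 : ℝ≥0∞) ≠ ∞) := ⟨by simp⟩
  obtain ⟨v, φ, hφ, h⟩ := exists_tendsto_weak hB
  exact ⟨v, φ, hφ, tendsto_of_weak_of_normSq_le hΩ hm hM (fun n => hB (φ n)) h fun n => hu (φ n)⟩

end Compactness

end LogLaplacian

namespace LogLaplacian

open MeasureTheory Real Set Filter Topology
open scoped ENNReal

/-! ### Eigenvectors of a closed semibounded form by successive minimisation. -/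

section Spectral

theorem eq_zero_of_forall_quadratic_nonneg {b c : ℝ} (h : ∀ t : ℝ, 0 ≤ 2 * b * t + c * t ^ 2) :
    b = 0 := by
  have := discrim_le_zero (a := c) (b := 2 * b) (c := 0) fun t => by
    have := h t
    nlinarith
  rw [discrim] at this
  nlinarith [sq_nonneg b]

variable {H : Type*} [NormedAddCommGroup H] [InnerProductSpace ℝ H] {V : Submodule ℝ H}

theorem le_of_forall_unit_le {B : V →ₗ[ℝ] V →ₗ[ℝ] ℝ} {W : Submodule ℝ V} {l : ℝ}
    (h : ∀ u ∈ W, ‖u‖ = 1 → l ≤ B u u) {u : V} (hu : u ∈ W) : l * ‖u‖ ^ 2 ≤ B u u := by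
  rcases eq_or_ne u 0 with rfl | h0
  · simp
  have hn : 0 < ‖u‖ := norm_pos_iff.2 h0
  have h1 := h (‖u‖⁻¹ • u) (W.smul_mem _ hu) (by
    rw [norm_smul, norm_inv, norm_norm, inv_mul_cancel₀ hn.ne'])
  simp only [map_smul, LinearMap.smul_apply, smul_eq_mul] at h1
  calc l * ‖u‖ ^ 2 ≤ ‖u‖⁻¹ * (‖u‖⁻¹ * B u u) * ‖u‖ ^ 2 := by gcongr
    _ = B u u := by field_simp

/-- A symmetric form that is bounded below, closed and has compact sublevel sets attains its minimum
over the unit sphere of a closed subspace. -/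
theorem exists_minimizer (B : V →ₗ[ℝ] V →ₗ[ℝ] ℝ) (hB : ∀ u v, B u v = B v u) {C : ℝ}
    (hC : ∀ u : V, 0 ≤ B u u + C * ‖u‖ ^ 2)
    (hcompact : ∀ (u : ℕ → V) (M : ℝ), (∀ n, ‖u n‖ = 1) → (∀ n, B (u n) (u n) ≤ M) →
      ∃ (a : H) (φ : ℕ → ℕ), StrictMono φ ∧ Tendsto (fun n => (u (φ n) : H)) atTop (𝓝 a))
    (hcomplete : ∀ (u : ℕ → V) (a : H), Tendsto (fun n => (u n : H)) atTop (𝓝 a) →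
      (∀ ε : ℝ, 0 < ε → ∃ n₀, ∀ n ≥ n₀, ∀ k ≥ n₀, B (u n - u k) (u n - u k) ≤ ε) →
      ∃ v : V, (v : H) = a ∧ Tendsto (fun n => B (u n - v) (u n - v)) atTop (𝓝 0))
    (W : Submodule ℝ V) (hW : IsClosed (W : Set V)) (hne : ∃ u ∈ W, u ≠ 0) :
    ∃ v ∈ W, ‖v‖ = 1 ∧ ∀ w ∈ W, B v v * ‖w‖ ^ 2 ≤ B w w := by
  set S : Set ℝ := (fun u : V => B u u) '' {u | u ∈ W ∧ ‖u‖ = 1} with hS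
  have hSne : S.Nonempty := by
    obtain ⟨u, hu, h0⟩ := hne
    refine ⟨_, ‖u‖⁻¹ • u, ⟨W.smul_mem _ hu, ?_⟩, rfl⟩
    rw [norm_smul, norm_inv, norm_norm, inv_mul_cancel₀ (norm_ne_zero_iff.2 h0)]
  have hSb : BddBelow S := by
    refine ⟨-C, ?_⟩
    rintro _ ⟨u, ⟨-, h1⟩, rfl⟩
    have := hC u
    rw [h1] at this
    simp only
    linarith
  set l := sInf S with hl
  have hmin : ∀ u ∈ W, l * ‖u‖ ^ 2 ≤ B u u := fun u hu =>
    le_of_forall_unit_le (fun w hw h1 => csInf_le hSb ⟨w, ⟨hw, h1⟩, rfl⟩) hu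
  obtain ⟨s, hanti, hs, hsS⟩ := exists_seq_tendsto_sInf hSne hSb
  choose u₀ hu₀ hsu using hsS
  obtain ⟨a, φ, hφ, ha⟩ := hcompact u₀ (s 0) (fun n => (hu₀ n).2) (fun n => by
    rw [show B (u₀ n) (u₀ n) = s n from hsu n]
    exact hanti (Nat.zero_le n))
  set u : ℕ → V := fun n => u₀ (φ n) with hu
  have hBu : Tendsto (fun n => B (u n) (u n)) atTop (𝓝 l) :=
    (hs.comp hφ.tendsto_atTop).congr fun n => (hsu (φ n)).symm
  have hadd : ∀ x y : V, B (x + y) (x + y) = B x x + 2 * B x y + B y y := fun x y => by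
    simp only [map_add, LinearMap.add_apply, hB y x]; ring
  have hsub : ∀ x y : V, B (x - y) (x - y) = B x x - 2 * B x y + B y y := fun x y => by
    simp only [map_sub, LinearMap.sub_apply, hB y x]; ring
  obtain ⟨v, hva, hv⟩ := hcomplete u a ha (by
    intro ε hε
    have hc := Metric.cauchySeq_iff.1 ha.cauchySeq
    -- Both tolerances come from the parallelogram law for `B`: with `d = u n - u k`, minimality of
    -- `l` at `u n + u k` gives `B d d ≤ ε/2 + |l| ‖d‖²`, and the last term is below `ε/2`.
    obtain ⟨n₁, hn₁⟩ := hc (√(ε / (2 * (|l| + 1)))) (by positivity)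
    obtain ⟨n₂, hn₂⟩ := eventually_atTop.1 (hBu.eventually_lt_const (by linarith : l < l + ε / 8))
    refine ⟨max n₁ n₂, fun n hn k hk => ?_⟩
    have e1 := hn₂ n (le_of_max_le_right hn)
    have e2 := hn₂ k (le_of_max_le_right hk)
    have e3 := hn₁ n (le_of_max_le_left hn) k (le_of_max_le_left hk)
    rw [dist_eq_norm] at e3
    change ‖u n - u k‖ < _ at e3
    rw [lt_sqrt (norm_nonneg _), lt_div_iff₀ (by positivity)] at e3
    have e4 := hmin (u n + u k) (W.add_mem (hu₀ _).1 (hu₀ _).1)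
    have e5 := parallelogram_law_with_norm ℝ (u n) (u k)
    rw [show ‖u n‖ = 1 from (hu₀ _).2, show ‖u k‖ = 1 from (hu₀ _).2] at e5
    have e6 : ‖u n + u k‖ ^ 2 = 4 - ‖u n - u k‖ ^ 2 := by nlinarith
    rw [e6] at e4
    have e7 := hadd (u n) (u k)
    rw [hsub]
    have e8 : l * ‖u n - u k‖ ^ 2 ≤ |l| * ‖u n - u k‖ ^ 2 := by
      gcongr
      exact le_abs_self l
    nlinarith [sq_nonneg ‖u n - u k‖])
  have huv : Tendsto u atTop (𝓝 v) := by
    rw [tendsto_subtype_rng, hva]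
    exact ha
  have hvW : v ∈ W := hW.mem_of_tendsto huv (Eventually.of_forall fun n => (hu₀ _).1)
  have hv1 : ‖v‖ = 1 :=
    tendsto_nhds_unique huv.norm (tendsto_const_nhds.congr fun n => ((hu₀ _).2).symm)
  refine ⟨v, hvW, hv1, fun w hw => le_trans ?_ (hmin w hw)⟩
  gcongr
  -- Semicontinuity at the limit. For the nonnegative form `Q = B + C‖·‖²`, the inequality `Q(v) ≤
  -- (1+t) Q(u n) + (1+t⁻¹) Q(u n - v)` follows from `Q(t • u n + (u n - v)) ≥ 0`. Let `n → ∞`, then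
  -- `t → 0`.
  have hlim : ∀ t : ℝ, 0 < t → B v v + C ≤ (1 + t) * (l + C) := by
    intro t ht
    have hd : Tendsto (fun n => ‖u n - v‖) atTop (𝓝 0) := tendsto_iff_norm_sub_tendsto_zero.1 huv
    have h1 : Tendsto (fun n => (1 + t) * (B (u n) (u n) + C)
        + (1 + t⁻¹) * (B (u n - v) (u n - v) + C * ‖u n - v‖ ^ 2)) atTop
        (𝓝 ((1 + t) * (l + C) + (1 + t⁻¹) * (0 + C * 0 ^ 2))) :=
      ((hBu.add_const C).const_mul _).add ((hv.add ((hd.pow 2).const_mul C)).const_mul _)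
    have h2 : (1 + t) * (l + C) + (1 + t⁻¹) * (0 + C * 0 ^ 2) = (1 + t) * (l + C) := by ring
    rw [h2] at h1
    refine ge_of_tendsto' h1 fun n => ?_
    have hun : ‖u n‖ = 1 := (hu₀ _).2
    have h3 := hC (t • u n + (u n - v))
    have h4 : ‖t • u n + (u n - v)‖ ^ 2
        = t ^ 2 + 2 * t * inner ℝ (u n) (u n - v) + ‖u n - v‖ ^ 2 := by
      rw [norm_add_sq_real, norm_smul, mul_pow, hun, real_inner_smul_left, norm_eq_abs, sq_abs]
      ring
    have h5 : (1 : ℝ) = 1 - 2 * inner ℝ (u n) (u n - v) + ‖u n - v‖ ^ 2 := by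
      have : ‖u n - (u n - v)‖ ^ 2 = 1 := by rw [sub_sub_cancel, hv1]; norm_num
      rw [norm_sub_sq_real, hun] at this
      linarith
    have h6 : B v v = B (u n) (u n) - 2 * B (u n) (u n - v) + B (u n - v) (u n - v) := by
      rw [← hsub, sub_sub_cancel]
    rw [h4, hadd] at h3
    simp only [map_smul, LinearMap.smul_apply, smul_eq_mul] at h3
    set q := B (u n) (u n)
    set r := B (u n) (u n - v)
    set d := B (u n - v) (u n - v)
    set i : ℝ := inner ℝ (u n) (u n - v)
    set e := ‖u n - v‖ ^ 2
    have h7 : 0 ≤ t⁻¹ * (t * (t * q) + 2 * (t * r) + d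
        + C * (t ^ 2 + 2 * t * i + e)) := by positivity
    have h8 : t⁻¹ * (t * (t * q) + 2 * (t * r) + d + C * (t ^ 2 + 2 * t * i + e))
        = t * (q + C) + 2 * r + 2 * C * i + t⁻¹ * (d + C * e) := by
      field_simp
      ring
    rw [h8] at h7
    have h9 : C = C * (1 - 2 * i + e) := by rw [← h5, mul_one]
    nlinarith
  have h1 : Tendsto (fun t : ℝ => (1 + t) * (l + C)) (𝓝[>] 0) (𝓝 ((1 + 0) * (l + C))) :=
    (Continuous.tendsto (by fun_prop) 0).mono_left nhdsWithin_le_nhds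
  have h2 := ge_of_tendsto h1 (eventually_mem_nhdsWithin.mono fun t ht => hlim t ht)
  linarith

/-- Each new eigenvector minimises the form on the orthogonal complement of the earlier ones; `hinf`
keeps that complement nonzero. Neither an ordering of the `μ i` nor completeness of the family is
needed, only the existence of arbitrarily many. -/
theorem exists_orthonormal_eigenvectors (B : V →ₗ[ℝ] V →ₗ[ℝ] ℝ) (hB : ∀ u v, B u v = B v u) {C : ℝ}
    (hC : ∀ u : V, 0 ≤ B u u + C * ‖u‖ ^ 2)
    (hcompact : ∀ (u : ℕ → V) (M : ℝ), (∀ n, ‖u n‖ = 1) → (∀ n, B (u n) (u n) ≤ M) →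
      ∃ (a : H) (φ : ℕ → ℕ), StrictMono φ ∧ Tendsto (fun n => (u (φ n) : H)) atTop (𝓝 a))
    (hcomplete : ∀ (u : ℕ → V) (a : H), Tendsto (fun n => (u n : H)) atTop (𝓝 a) →
      (∀ ε : ℝ, 0 < ε → ∃ n₀, ∀ n ≥ n₀, ∀ k ≥ n₀, B (u n - u k) (u n - u k) ≤ ε) →
      ∃ v : V, (v : H) = a ∧ Tendsto (fun n => B (u n - v) (u n - v)) atTop (𝓝 0))
    (hinf : ∀ (k : ℕ) (φ : Fin k → H), ∃ v ∈ V, v ≠ 0 ∧ ∀ i, inner ℝ (φ i) v = 0) (k : ℕ) :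
    ∃ (μ : Fin k → ℝ) (φ : Fin k → V), Orthonormal ℝ φ ∧
      ∀ i v, B (φ i) v = μ i * inner ℝ (φ i) v := by
  induction k with
  | zero => exact ⟨Fin.elim0, Fin.elim0, ⟨fun i => i.elim0, fun i => i.elim0⟩, fun i => i.elim0⟩
  | succ k ih =>
    obtain ⟨μ, φ, hφ, he⟩ := ih
    let W : Submodule ℝ V := (Submodule.span ℝ (range φ))ᗮ
    have hWmem : ∀ w : V, w ∈ W ↔ ∀ i, inner ℝ (φ i) w = 0 := by
      intro w
      rw [Submodule.mem_orthogonal]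
      refine ⟨fun h i => h _ (Submodule.subset_span ⟨i, rfl⟩), fun h x hx => ?_⟩
      induction hx using Submodule.span_induction with
      | mem x hx => obtain ⟨i, rfl⟩ := hx; exact h i
      | zero => simp
      | add x y _ _ hx hy => rw [inner_add_left, hx, hy, add_zero]
      | smul c x _ hx => rw [real_inner_smul_left, hx, mul_zero]
    obtain ⟨v, hvW, hv1, hmin⟩ := exists_minimizer B hB hC hcompact hcomplete W
      (Submodule.isClosed_orthogonal _) (by
        obtain ⟨w, hw, h0, horth⟩ := hinf k fun i => φ i
        exact ⟨⟨w, hw⟩, (hWmem _).2 horth, fun h => h0 (congrArg Subtype.val h)⟩)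
    have hvφ := (hWmem v).1 hvW
    -- Euler–Lagrange equation: the quadratic polynomial in `t` obtained by varying `v` along `w` is
    -- nonnegative and vanishes at 0, so its linear coefficient is zero.
    have hEL : ∀ w ∈ W, B v w = B v v * inner ℝ v w := by
      intro w hw
      rw [← sub_eq_zero]
      refine eq_zero_of_forall_quadratic_nonneg (c := B w w - B v v * ‖w‖ ^ 2) fun t => ?_
      have h1 := hmin (v + t • w) (W.add_mem hvW (W.smul_mem t hw))
      rw [norm_add_sq_real, norm_smul, mul_pow, hv1, real_inner_smul_right, norm_eq_abs,
        sq_abs] at h1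
      simp only [map_add, map_smul, LinearMap.add_apply, LinearMap.smul_apply, smul_eq_mul,
        hB w v] at h1
      nlinarith
    -- The equation extends from `W` to all of `V`: on the span of the earlier eigenvectors both
    -- sides vanish, by symmetry of `B` and orthogonality.
    have hall : ∀ w, B v w = B v v * inner ℝ v w := by
      intro w
      set p : V := ∑ i, (inner ℝ (φ i) w : ℝ) • φ i with hp
      have h1 : w - p ∈ W := by
        rw [hWmem]
        intro i
        rw [inner_sub_right, hp, hφ.inner_right_fintype, sub_self]
      have h2 : B v p = 0 := by
        rw [hp, map_sum]
        refine Finset.sum_eq_zero fun i _ => ?_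
        rw [map_smul, hB, he, hvφ, mul_zero, smul_zero]
      have h3 : inner ℝ v p = 0 := by
        rw [hp, inner_sum]
        refine Finset.sum_eq_zero fun i _ => ?_
        rw [real_inner_smul_right, real_inner_comm (φ i) v, hvφ, mul_zero]
      have h4 := hEL _ h1
      rwa [map_sub, inner_sub_right, h2, h3, sub_zero, sub_zero] at h4
    refine ⟨Fin.cons (B v v) μ, Fin.cons v φ, ⟨?_, ?_⟩, ?_⟩
    · intro i
      refine Fin.cases ?_ (fun j => ?_) i
      · simpa using hv1
      · simpa using hφ.1 j
    · intro i j
      refine Fin.cases ?_ (fun i => ?_) i <;> refine Fin.cases ?_ (fun j => ?_) j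
      · simp
      · intro _
        simpa [real_inner_comm] using hvφ j
      · intro _
        simpa using hvφ i
      · intro h
        simpa using hφ.2 (fun h' => h (by rw [h']))
    · intro i
      refine Fin.cases ?_ (fun j => ?_) i
      · simpa using hall
      · simpa using he j

end Spectral

/-! ### Existence of arbitrarily many Dirichlet eigenvalues. -/

section Existence

variable {N : ℕ} {Ω : Set (EuclideanSpace ℝ (Fin N))}

/-- A nonempty open set carries arbitrarily many test functions with disjoint supports. -/
theorem exists_linearIndependent_testSpace (hN : 1 ≤ N) (hΩ : IsOpen Ω) (hne : Ω.Nonempty) (k : ℕ) :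
    ∃ b : Fin k → L2 Ω, (∀ i, b i ∈ testSpace Ω) ∧ LinearIndependent ℝ b := by
  have : Nonempty (Fin N) := ⟨⟨0, hN⟩⟩
  obtain ⟨x₀, hx₀⟩ := hne
  have hinf : Ω.Infinite := infinite_of_mem_nhds x₀ (hΩ.mem_nhds hx₀)
  obtain ⟨t, htΩ, htk⟩ := hinf.exists_subset_card_eq k
  let x : Fin k → EuclideanSpace ℝ (Fin N) := fun i => (t.equivFinOfCardEq htk).symm i
  have hxΩ : ∀ i, x i ∈ Ω := fun i => htΩ ((t.equivFinOfCardEq htk).symm i).2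
  have hxinj : Function.Injective x :=
    Subtype.val_injective.comp (t.equivFinOfCardEq htk).symm.injective
  obtain ⟨U, hU, hdisj⟩ := (finite_range x).t2_separation
  have hnhds : ∀ i, U (x i) ∩ Ω ∈ 𝓝 (x i) := fun i =>
    inter_mem ((hU (x i)).2.mem_nhds (hU (x i)).1) (hΩ.mem_nhds (hxΩ i))
  choose f hfs hfc hfd _ hf1 using fun i =>
    exists_contDiff_tsupport_subset (n := (⊤ : ℕ∞)) (hnhds i)
  have hf : ∀ i, IsTestFunction Ω (f i) := fun i =>
    ⟨hfd i, hfc i, (hfs i).trans inter_subset_right⟩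
  refine ⟨fun i => (hf i).memLp.toLp (f i), fun i => ⟨f i, hf i, (hf i).memLp.coeFn_toLp⟩,
    linearIndependent_of_ne_zero_of_inner_eq_zero (𝕜 := ℝ) ?_ ?_⟩
  · intro i h
    have h1 : f i =ᵐ[volume.restrict Ω] 0 :=
      ((hf i).memLp.coeFn_toLp.symm.trans (by rw [h])).trans (Lp.coeFn_zero _ _ _)
    have h2 := Measure.eqOn_open_of_ae_eq h1 hΩ (hfd i).continuous.continuousOn
      continuousOn_const (hxΩ i)
    simp [hf1 i] at h2
  · intro i j hij
    rw [L2.inner_def]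
    refine integral_eq_zero_of_ae ?_
    filter_upwards [(hf i).memLp.coeFn_toLp, (hf j).memLp.coeFn_toLp] with y h1 h2
    rw [h1, h2]
    by_contra hy
    simp only [RCLike.inner_apply, conj_trivial, Pi.zero_apply, mul_eq_zero, not_or] at hy
    have d := hdisj (mem_range_self i) (mem_range_self j) (hxinj.ne hij)
    exact disjoint_left.1 d (hfs i (subset_tsupport _ hy.2)).1 (hfs j (subset_tsupport _ hy.1)).1

/-- There are `k + 1` independent test functions and only `k` linear conditions. -/
theorem exists_testSpace_orthogonal (hN : 1 ≤ N) (hΩ : IsOpen Ω) (hne : Ω.Nonempty) {k : ℕ}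
    (φ : Fin k → L2 Ω) : ∃ v ∈ testSpace Ω, v ≠ 0 ∧ ∀ i, inner ℝ (φ i) v = 0 := by
  obtain ⟨b, hb, hli⟩ := exists_linearIndependent_testSpace hN hΩ hne (k + 1)
  let T : (Fin (k + 1) → ℝ) →ₗ[ℝ] (Fin k → ℝ) :=
    LinearMap.pi (fun i => (innerₗ (L2 Ω) (φ i))) ∘ₗ Fintype.linearCombination ℝ b
  have hT : T.ker ≠ ⊥ := LinearMap.ker_ne_bot_of_finrank_lt (by simp)
  obtain ⟨c, hc, hc0⟩ := Submodule.exists_mem_ne_zero_of_ne_bot hT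
  refine ⟨∑ i, c i • b i, Submodule.sum_mem _ fun i _ => Submodule.smul_mem _ _ (hb i), ?_, ?_⟩
  · intro h
    exact hc0 (funext (Fintype.linearIndependent_iff.1 hli c h))
  · intro i
    have := congrFun (LinearMap.mem_ker.1 hc) i
    simpa [T, Fintype.linearCombination_apply, inner_sum, inner_smul_right] using this

/-- There are infinitely many Dirichlet eigenvalues. -/
theorem exists_hasEigenvaluesBelow [IsFiniteMeasure
      ((volume : Measure (EuclideanSpace ℝ (Fin N))).restrict Ω)]
    (hN : 1 ≤ N) (hΩ : IsOpen Ω) (hne : Ω.Nonempty) {m : ℕ} (hm : 2 ≤ m) (k : ℕ) :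
    ∃ t, HasEigenvaluesBelow m Ω k t := by
  have hΩm := hΩ.measurableSet
  have hP : (0 : ℝ) < (2 * π) ^ N := by positivity
  obtain ⟨C, hC0, hC⟩ := exists_garding hΩm hN hm
  obtain ⟨μ, φ, hφ, he⟩ := exists_orthonormal_eigenvectors (formBilin hΩm hN hm)
    (fun u v => form_comm m (u : L2 Ω) v) (C := C)
    (fun u => by
      have := (hC u u.2).1
      exact nonneg_of_mul_nonneg_right (ENNReal.toReal_nonneg.trans this) hP)
    (fun u M hu1 huM => by
      refine exists_subseq_tendsto hΩm (m := m) (by omega)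
        (M := ENNReal.ofReal ((2 * π) ^ N * (M + C))) ENNReal.ofReal_lt_top (B := 1)
        (u := fun n => (u n : L2 Ω)) (fun n => (hu1 n).le) fun n => ?_
      rw [ENNReal.le_ofReal_iff_toReal_le (normSq_lt_top_of_mem hΩm (u n).2).ne]
      · refine (hC _ (u n).2).1.trans ?_
        have h1 : ‖(u n : L2 Ω)‖ = 1 := hu1 n
        have h2 : form m Ω (u n) (u n) ≤ M := huM n
        rw [h1]
        gcongr
        linarith
      · have h1 : ‖(u n : L2 Ω)‖ = 1 := hu1 n
        have h2 : form m Ω (u n) (u n) ≤ M := huM n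
        have h3 := ENNReal.toReal_nonneg.trans (hC _ (u n).2).1
        refine h3.trans ?_
        rw [h1]
        gcongr
        linarith)
    (fun u a ha hcau => by
      have hd : ∀ ε : ℝ, 0 < ε → ∃ n₀, ∀ n ≥ n₀, ∀ k ≥ n₀, ‖(u n - u k : L2 Ω)‖ ^ 2 ≤ ε := by
        intro ε hε
        obtain ⟨n₀, h⟩ := Metric.cauchySeq_iff.1 ha.cauchySeq (√ε) (by positivity)
        refine ⟨n₀, fun n hn k hk => ?_⟩
        have := h n hn k hk
        rw [dist_eq_norm, lt_sqrt (norm_nonneg _)] at this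
        exact this.le
      obtain ⟨hv, hlim⟩ := mem_energySpace_of_cauchy hΩm (m := m) (fun n => (u n).2) ha (by
        intro ε hε
        rcases eq_or_ne ε ∞ with rfl | hε'
        · exact ⟨0, fun _ _ _ _ => le_top⟩
        have hε0 : 0 < ε.toReal := ENNReal.toReal_pos hε.ne' hε'
        obtain ⟨n₁, h₁⟩ := hcau (ε.toReal / (2 * (2 * π) ^ N)) (by positivity)
        obtain ⟨n₂, h₂⟩ := hd (ε.toReal / (2 * (2 * π) ^ N * (C + 1))) (by positivity)
        refine ⟨max n₁ n₂, fun n hn k hk => ?_⟩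
        have hmem := (u n - u k).2
        rw [← Submodule.coe_sub, ← ENNReal.toReal_le_toReal (normSq_lt_top_of_mem hΩm hmem).ne hε']
        refine (hC _ hmem).1.trans ?_
        have e1 : form m Ω (u n - u k : energySubmodule hΩm m) (u n - u k : energySubmodule hΩm m)
            ≤ ε.toReal / (2 * (2 * π) ^ N) :=
          h₁ n (le_of_max_le_left hn) k (le_of_max_le_left hk)
        have e2 := h₂ n (le_of_max_le_right hn) k (le_of_max_le_right hk)
        rw [← Submodule.coe_sub, le_div_iff₀ (by positivity)] at e2
        rw [le_div_iff₀ (by positivity)] at e1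
        have e3 : 0 ≤ ‖((u n - u k : energySubmodule hΩm m) : L2 Ω)‖ ^ 2 := sq_nonneg _
        nlinarith)
      refine ⟨⟨a, hv⟩, rfl, ?_⟩
      have hd0 : Tendsto (fun n => ‖(u n : L2 Ω) - a‖ ^ 2) atTop (𝓝 0) := by
        simpa using (tendsto_iff_norm_sub_tendsto_zero.1 ha).pow 2
      have hn0 : Tendsto (fun n => (normSq m Ω ((u n : L2 Ω) - a : L2 Ω)).toReal) atTop (𝓝 0) := by
        have := (ENNReal.tendsto_toReal ENNReal.zero_ne_top).comp hlim
        rwa [ENNReal.toReal_zero] at this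
      refine tendsto_of_tendsto_of_tendsto_of_le_of_le
        (g := fun n => -(C * ‖(u n : L2 Ω) - a‖ ^ 2))
        (h := fun n => ((2 * π) ^ N)⁻¹ * (2 ^ m * (normSq m Ω ((u n : L2 Ω) - a : L2 Ω)).toReal)
          + C * ‖(u n : L2 Ω) - a‖ ^ 2) ?_ ?_ (fun n => ?_) fun n => ?_
      · simpa using (hd0.const_mul C).neg
      · simpa using ((hn0.const_mul (2 ^ m)).const_mul ((2 * π) ^ N)⁻¹).add (hd0.const_mul C)
      · have h1 := ENNReal.toReal_nonneg.trans (hC _ (u n - ⟨a, hv⟩ : energySubmodule hΩm m).2).1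
        have h2 := nonneg_of_mul_nonneg_right h1 hP
        simp only [formBilin_apply]
        have h3 : ((u n - ⟨a, hv⟩ : energySubmodule hΩm m) : L2 Ω) = u n - a := rfl
        rw [h3] at h2 ⊢
        linarith
      · have h1 := (hC _ (u n - ⟨a, hv⟩ : energySubmodule hΩm m).2).2
        have h3 : ((u n - ⟨a, hv⟩ : energySubmodule hΩm m) : L2 Ω) = u n - a := rfl
        simp only [formBilin_apply]
        rw [h3] at h1 ⊢
        rw [← sub_le_iff_le_add, ← mul_le_mul_iff_right₀ hP, mul_inv_cancel_left₀ hP.ne']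
        linarith)
    (fun k φ => by
      obtain ⟨v, hv, h⟩ := exists_testSpace_orthogonal hN hΩ hne φ
      exact ⟨v, testSpace_le_energySubmodule hΩm m hv, h⟩) k
  -- Any common upper bound of the `μ i` serves; the sum of absolute values is a convenient one.
  refine ⟨∑ i, |μ i|, μ, fun i => φ i, ⟨hφ.1, hφ.2⟩, fun i => ⟨⟨(φ i).2, ?_, ?_⟩, ?_⟩⟩
  · intro h
    have h1 : ‖(φ i : L2 Ω)‖ = 1 := hφ.1 i
    rw [show (φ i : L2 Ω) = 0 from h, norm_zero] at h1
    exact zero_ne_one h1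
  · intro v hv
    exact he i ⟨v, hv⟩
  · exact (le_abs_self _).trans
      (Finset.single_le_sum (f := fun i => |μ i|) (fun _ _ => abs_nonneg _) (Finset.mem_univ i))

end Existence

end LogLaplacian

namespace LogLaplacian

open MeasureTheory Real Set Filter Topology
open scoped ENNReal

/-! ### Lower bounds for eigenvalues. -/

section EigenvalueBounds

variable {N : ℕ} {Ω : Set (EuclideanSpace ℝ (Fin N))}

theorem IsEigenfunction.form_self_eq {m : ℕ} {μ : ℝ} {φ : L2 Ω} (h : IsEigenfunction m Ω μ φ)
    (h1 : ‖φ‖ = 1) : form m Ω φ φ = μ := by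
  rw [h.2.2 φ h.1, real_inner_self_eq_norm_sq, h1]
  ring

theorem HasEigenvaluesBelow.mono {m j k : ℕ} (hjk : j ≤ k) {t : ℝ}
    (h : HasEigenvaluesBelow m Ω k t) : HasEigenvaluesBelow m Ω j t := by
  obtain ⟨μ, φ, hφ, h⟩ := h
  exact ⟨μ ∘ Fin.castLE hjk, φ ∘ Fin.castLE hjk, hφ.comp _ (Fin.castLE_injective hjk),
    fun i => h _⟩

theorem HasEigenvaluesBelow.nonneg_of_even {m k : ℕ} (hm : Even m) (hk : 1 ≤ k) {t : ℝ}
    (h : HasEigenvaluesBelow m Ω k t) : 0 ≤ t := by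
  obtain ⟨μ, φ, hφ, h⟩ := h
  have h0 := h ⟨0, hk⟩
  refine le_trans ?_ h0.2
  rw [← h0.1.form_self_eq (hφ.1 _)]
  have hP : (0 : ℝ) < (2 * π) ^ N := by positivity
  refine nonneg_of_mul_nonneg_right ?_ hP
  rw [form_self]
  exact integral_nonneg fun ξ => mul_nonneg (hm.pow_nonneg _) (sq_nonneg _)

theorem sphereVolume_pos (hN : 1 ≤ N) : 0 < sphereVolume N := by
  rw [sphereVolume, ← Measure.real, Measure.toSphere_real_apply_univ, finrank_euclideanSpace_fin]
  have : 0 < volume.real (Metric.ball (0 : EuclideanSpace ℝ (Fin N)) 1) :=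
    ENNReal.toReal_pos (Metric.measure_ball_pos _ _ one_pos).ne' measure_ball_lt_top.ne
  have : (0 : ℝ) < N := by exact_mod_cast hN
  positivity

theorem coeffA_pos (hN : 1 ≤ N) {m : ℕ} (hm : 2 ≤ m) : 0 < coeffA N m := by
  have := sphereVolume_pos hN
  have : (0 : ℝ) < N := by exact_mod_cast hN
  have : (0 : ℝ) < m := by exact_mod_cast (by omega : 0 < m)
  rw [coeffA]
  positivity

/-- Apart from positivity, this is the only property of `b_m` that the theorem uses. It makes the
estimate trivial when `k/|Ω|` is small. -/
theorem two_div_pow_le_coeffB (hN : 1 ≤ N) {m : ℕ} (hm : 2 ≤ m) :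
    (2 / (N : ℝ)) ^ m ≤ coeffB N m := by
  have : (0 : ℝ) < N := by exact_mod_cast hN
  have h1 : (1 : ℝ) ≤ ((m : ℝ) - 1) ^ m := by
    refine one_le_pow₀ ?_
    have : (2 : ℝ) ≤ m := by exact_mod_cast hm
    linarith
  rw [coeffB, div_pow]
  have h2 : (2 : ℝ) ^ m / (N : ℝ) ^ m * 1 ≤ 2 ^ m / (N : ℝ) ^ m * ((m : ℝ) - 1) ^ m := by gcongr
  have h3 : (0 : ℝ) < 1 / (N : ℝ) ^ m := by positivity
  linarith

theorem coeffB_pos (hN : 1 ≤ N) {m : ℕ} (hm : 2 ≤ m) : 0 < coeffB N m := by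
  have : (0 : ℝ) < N := by exact_mod_cast hN
  exact lt_of_lt_of_le (by positivity) (two_div_pow_le_coeffB hN hm)

variable [IsFiniteMeasure ((volume : Measure (EuclideanSpace ℝ (Fin N))).restrict Ω)]

/-- The Berezin–Li–Yau inequality for the logarithmic Laplacian. -/
theorem HasEigenvaluesBelow.le {m k : ℕ} {t τ : ℝ} (h : HasEigenvaluesBelow m Ω k t)
    (hΩ : MeasurableSet Ω) (hv : 0 < vol Ω) (hN : 1 ≤ N) (hm : 2 ≤ m) (hk : 1 ≤ k)
    (hτ : 2 ^ (m + 1) * m.factorial ≤ τ) :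
    (2 / (N : ℝ)) ^ m * τ ^ m - τ ^ (m - 1) * exp τ / (coeffA N m * (k / vol Ω)) ≤ t := by
  obtain ⟨g, hg, hg0, hgL, -, hgi⟩ := exists_log_defect hN hm hτ
  obtain ⟨μ, φ, hφ, he⟩ := h
  have hP : (0 : ℝ) < (2 * π) ^ N := by positivity
  have hN' : (0 : ℝ) < N := by exact_mod_cast hN
  have hk' : (0 : ℝ) < k := by exact_mod_cast hk
  have hm' : (0 : ℝ) < m := by exact_mod_cast (by omega : 0 < m)
  have hs := sphereVolume_pos hN
  set L : ℝ := (2 * τ / N) ^ m with hL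
  -- Per eigenfunction: bound the symbol below by `L - g` and use Plancherel for the constant part.
  -- Bessel is applied only after summing over `i`, so the defect costs `|Ω| ∫ g` in total and not
  -- once for each `i`.
  have hi : ∀ i, L * (2 * π) ^ N - ∫ ξ, g ξ * ‖hat Ω (φ i) ξ‖ ^ 2 ≤ (2 * π) ^ N * t := by
    intro i
    have hn1 : ‖φ i‖ = 1 := hφ.1 i
    have h1 : (2 * π) ^ N * μ i = ∫ ξ, (2 * log ‖ξ‖) ^ m * ‖hat Ω (φ i) ξ‖ ^ 2 := by
      rw [← form_self, (he i).1.form_self_eq hn1]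
    have h2 : L * (2 * π) ^ N = ∫ ξ, L * ‖hat Ω (φ i) ξ‖ ^ 2 := by
      rw [integral_const_mul, integral_norm_sq_hat hΩ, hn1]; ring
    have i1 := integrable_mul_norm_sq_hat hΩ hg (φ i)
    have i2 := (integrable_norm_sq_hat hΩ (φ i)).const_mul L
    calc _ ≤ (2 * π) ^ N * μ i := by
          rw [h1, h2, ← integral_sub i2 i1]
          refine integral_mono (i2.sub i1)
            (integrable_symbol_mul_norm_sq hΩ hN hm (he i).1.1) fun ξ => ?_
          simp only [← sub_mul]
          exact mul_le_mul_of_nonneg_right (by linarith [hgL ξ]) (sq_nonneg _)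
      _ ≤ _ := by
        gcongr
        exact (he i).2
  have hsum : ∑ i, ∫ ξ, g ξ * ‖hat Ω (φ i) ξ‖ ^ 2 ≤ vol Ω * ∫ ξ, g ξ := by
    rw [← integral_finsetSum _ fun i _ => integrable_mul_norm_sq_hat hΩ hg (φ i),
      ← integral_const_mul]
    refine integral_mono (integrable_finsetSum _ fun i _ =>
      integrable_mul_norm_sq_hat hΩ hg (φ i)) (hg.const_mul _) fun ξ => ?_
    simp only [← Finset.mul_sum]
    rw [mul_comm]
    exact mul_le_mul_of_nonneg_right (sum_norm_sq_hat_le hφ ξ) (hg0 ξ)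
  have htot := Finset.sum_le_sum fun i (_ : i ∈ Finset.univ) => hi i
  simp only [Finset.sum_sub_distrib, Finset.sum_const, Finset.card_univ, Fintype.card_fin,
    nsmul_eq_mul] at htot
  have h3 : vol Ω * ∫ ξ, g ξ
      ≤ vol Ω * (sphereVolume N * (m * 2 ^ m / N ^ (m + 1) * (τ ^ (m - 1) * exp τ))) := by
    gcongr
  have h4 : (k : ℝ) * ((2 * π) ^ N) * (L - τ ^ (m - 1) * exp τ / (coeffA N m * (k / vol Ω)))
      = k * (L * (2 * π) ^ N) - vol Ω * (sphereVolume N * (m * 2 ^ m / N ^ (m + 1)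
        * (τ ^ (m - 1) * exp τ))) := by
    rw [coeffA]
    field_simp
  have h5 : (2 / (N : ℝ)) ^ m * τ ^ m = L := by rw [hL, ← mul_pow]; congr 1; ring
  rw [h5]
  refine le_of_mul_le_mul_left ?_ (mul_pos hk' hP)
  rw [h4]
  linarith

theorem bddBelow_hasEigenvaluesBelow (hΩ : MeasurableSet Ω) (hv : 0 < vol Ω) (hN : 1 ≤ N) {m k : ℕ}
    (hm : 2 ≤ m) (hk : 1 ≤ k) : BddBelow {t | HasEigenvaluesBelow m Ω k t} :=
  ⟨_, fun _ ht => HasEigenvaluesBelow.le ht hΩ hv hN hm hk le_rfl⟩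

theorem eigenvalue_one_le (hΩ : IsOpen Ω) (hne : Ω.Nonempty) (hv : 0 < vol Ω) (hN : 1 ≤ N)
    {m k : ℕ} (hm : 2 ≤ m) (hk : 1 ≤ k) : eigenvalue m Ω 1 ≤ eigenvalue m Ω k :=
  csInf_le_csInf (bddBelow_hasEigenvaluesBelow hΩ.measurableSet hv hN hm le_rfl)
    (exists_hasEigenvaluesBelow hN hΩ hne hm k) fun _ ht => HasEigenvaluesBelow.mono hk ht

/-- The choice of `τ` makes the defect term in the Berezin–Li–Yau bound exactly `p`. -/
theorem le_eigenvalue (hΩ : IsOpen Ω) (hne : Ω.Nonempty) (hv : 0 < vol Ω) (hN : 1 ≤ N) {m k : ℕ}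
    (hm : 2 ≤ m) (hk : 1 ≤ k) {τ p : ℝ} (hp : 0 < p) (hτ : 2 ^ (m + 1) * m.factorial ≤ τ)
    (hX : τ ^ (m - 1) * exp τ = coeffA N m * p * (k / vol Ω)) :
    (2 / (N : ℝ)) ^ m * τ ^ m - p ≤ eigenvalue m Ω k := by
  refine le_csInf (exists_hasEigenvaluesBelow hN hΩ hne hm k) fun t ht => ?_
  have h := HasEigenvaluesBelow.le ht hΩ.measurableSet hv hN hm hk hτ
  have hA := coeffA_pos hN hm
  have hk' : (0 : ℝ) < k := by exact_mod_cast hk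
  have e : coeffA N m * p * (k / vol Ω) / (coeffA N m * (k / vol Ω)) = p := by
    field_simp
  rwa [hX, e] at h

omit [IsFiniteMeasure ((volume : Measure (EuclideanSpace ℝ (Fin N))).restrict Ω)] in
theorem eigenvalue_nonneg_of_even {m k : ℕ} (hm : Even m) (hk : 1 ≤ k) : 0 ≤ eigenvalue m Ω k :=
  Real.sInf_nonneg fun _ ht => HasEigenvaluesBelow.nonneg_of_even hm hk ht

end EigenvalueBounds

/-! ### Explicit lower bounds for the solution of `τ^{m-1} e^τ = X`. -/

section Numerics

theorem exists_pow_mul_exp_eq (n : ℕ) {T X : ℝ} (hT : 1 ≤ T) (hX : T ^ n * exp T ≤ X) :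
    ∃ τ, T ≤ τ ∧ τ ^ n * exp τ = X := by
  have h1 : ∀ s : ℝ, 1 ≤ s → s ≤ s ^ n * exp s := fun s hs => by
    have h2 := add_one_le_exp s
    have h3 : 1 ≤ s ^ n := one_le_pow₀ hs
    nlinarith
  have hTX : T ≤ X := (h1 T hT).trans hX
  obtain ⟨τ, hτ, h⟩ := intermediate_value_Icc hTX (f := fun s => s ^ n * exp s)
    (by fun_prop) ⟨hX, h1 X (hT.trans hTX)⟩
  exact ⟨τ, hτ.1, h⟩

/-- For `τ ≤ τ₀` the exponential factor is at most `e^{τ₀}`, so `X / e^{τ₀} ≤ τ^{m-1}`; raise this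
to the power `m/(m-1)`. -/
theorem rpow_div_exp_le_pow {m : ℕ} (hm : 2 ≤ m) {τ τ₀ X : ℝ} (h0 : 0 ≤ τ) (hτ : τ ≤ τ₀)
    (hX : τ ^ (m - 1) * exp τ = X) : (X / exp τ₀) ^ ((m : ℝ) / ((m : ℝ) - 1)) ≤ τ ^ m := by
  have hm1 : (0 : ℝ) < (m : ℝ) - 1 := by
    have : (2 : ℝ) ≤ m := by exact_mod_cast hm
    linarith
  have h1 : X / exp τ₀ ≤ τ ^ (m - 1) := by
    rw [div_le_iff₀ (exp_pos _), ← hX]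
    gcongr
  have h2 : 0 ≤ X / exp τ₀ := by rw [← hX]; positivity
  calc _ ≤ (τ ^ (m - 1)) ^ ((m : ℝ) / ((m : ℝ) - 1)) := by gcongr
    _ = τ ^ m := by
      rw [← rpow_natCast, ← rpow_mul h0, ← rpow_natCast τ m]
      congr 1
      rw [Nat.cast_sub (by omega), Nat.cast_one]
      field_simp

/-- Taking logarithms, `τ = log X - (m-1) log τ`, and `τ ≤ log X`. The extra summand is at most `X`,
which costs the `log 2`. -/
theorem log_add_sub_log_log_le {m : ℕ} {τ τ₀ X : ℝ} (hm : 2 ≤ m) (h1 : 1 ≤ τ₀) (hτ : τ₀ ≤ τ)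
    (hX : τ ^ (m - 1) * exp τ = X) :
    log (X + τ₀ ^ (m - 1) * exp τ₀) - ((m : ℝ) - 1) * log (log (X + exp 1)) - log 2 ≤ τ := by
  have hτ1 : 1 ≤ τ := h1.trans hτ
  have hm1 : (0 : ℝ) ≤ (m : ℝ) - 1 := by
    have : (2 : ℝ) ≤ m := by exact_mod_cast hm
    linarith
  have hX0 : 0 < X := by rw [← hX]; positivity
  have hlogX : log X = ((m : ℝ) - 1) * log τ + τ := by
    rw [← hX, log_mul (by positivity) (by positivity), log_exp, log_pow,
      Nat.cast_sub (by omega), Nat.cast_one]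
  have h2 : log (X + τ₀ ^ (m - 1) * exp τ₀) ≤ log 2 + log X := by
    rw [← log_mul (by norm_num) hX0.ne']
    refine log_le_log (by positivity) ?_
    have : τ₀ ^ (m - 1) * exp τ₀ ≤ X := by
      rw [← hX]
      gcongr
    linarith
  have h3 : log τ ≤ log (log (X + exp 1)) := by
    refine log_le_log (by positivity) ?_
    have : log X ≤ log (X + exp 1) := log_le_log hX0 (by linarith [exp_pos 1])
    have : 0 ≤ ((m : ℝ) - 1) * log τ := mul_nonneg hm1 (log_nonneg hτ1)
    linarith
  have h4 := mul_le_mul_of_nonneg_left h3 hm1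
  linarith

/-- For even `m`, the comparison of `m`-th powers needs a nonnegative base. Since `log (X + e) ≤
(m+1) τ`, the iterated logarithm is at most `m + log τ`, and the expression is at least `τ - m(m-1)
- 1`; hence the condition `m² + 1 ≤ τ₀`. -/
theorem log_add_sub_log_log_nonneg {m : ℕ} {τ τ₀ X : ℝ} (hm : 2 ≤ m) (h1 : (m : ℝ) ^ 2 + 1 ≤ τ₀)
    (hτ : τ₀ ≤ τ) (hX : τ ^ (m - 1) * exp τ = X) :
    0 ≤ log (X + τ₀ ^ (m - 1) * exp τ₀) - ((m : ℝ) - 1) * log (log (X + exp 1)) - log 2 := by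
  have hm2 : (2 : ℝ) ≤ m := by exact_mod_cast hm
  have hm1 : (0 : ℝ) ≤ (m : ℝ) - 1 := by linarith
  have hτ1 : 1 ≤ τ := by nlinarith
  have hτ0 : 0 < τ₀ := by nlinarith
  have hX0 : 0 < X := by rw [← hX]; positivity
  have hlogX : log X = ((m : ℝ) - 1) * log τ + τ := by
    rw [← hX, log_mul (by positivity) (by positivity), log_exp, log_pow,
      Nat.cast_sub (by omega), Nat.cast_one]
  have h2 : log X ≤ log (X + τ₀ ^ (m - 1) * exp τ₀) :=
    log_le_log hX0 (by have : 0 ≤ τ₀ ^ (m - 1) * exp τ₀ := by positivity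
                       linarith)
  have hl2 : log 2 ≤ 1 := by linarith [log_two_lt_d9]
  have heX : exp 1 ≤ X := by
    rw [← hX]
    have h5 : 1 ≤ τ ^ (m - 1) := one_le_pow₀ hτ1
    have h6 : exp 1 ≤ exp τ := exp_le_exp.2 hτ1
    nlinarith [exp_pos τ]
  have h3 : log (X + exp 1) ≤ (m + 1) * τ := by
    have h5 : log (X + exp 1) ≤ log 2 + log X := by
      rw [← log_mul (by norm_num) hX0.ne']
      exact log_le_log (by positivity) (by linarith)
    have h6 : ((m : ℝ) - 1) * log τ ≤ ((m : ℝ) - 1) * τ := by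
      gcongr
      linarith [log_le_sub_one_of_pos (show 0 < τ by linarith)]
    linarith
  have h7 : log (log (X + exp 1)) ≤ m + log τ := by
    have h8 : 1 ≤ log (X + exp 1) := by
      rw [add_comm]
      exact one_le_log_exp_one_add hX0.le
    have h9 : log (log (X + exp 1)) ≤ log ((m + 1) * τ) := log_le_log (by linarith) h3
    rw [log_mul (by positivity) (by positivity)] at h9
    have := log_le_sub_one_of_pos (show (0 : ℝ) < m + 1 by positivity)
    linarith
  have h10 := mul_le_mul_of_nonneg_left h7 hm1
  nlinarith

end Numerics

end LogLaplacian

/-! ### Assembly of the theorem. -/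

open LogLaplacian
theorem theorem1p2 (m : ℕ) (hm : 2 ≤ m) :
    ∃ τ₀ : ℝ, 1 < τ₀ ∧
      ∀ N : ℕ, 1 ≤ N →
      ∀ Ω : Set (EuclideanSpace ℝ (Fin N)), IsOpen Ω → Ω.Nonempty → Bornology.IsBounded Ω →
      ∀ k : ℕ, 2 ≤ k →
        ((Even m ∨ (Odd m ∧ 0 ≤ eigenvalue m Ω 1)) →
          (2 / (N : ℝ)) ^ m *
              min
                ((coeffC N m / Real.exp τ₀) ^ ((m : ℝ) / ((m : ℝ) - 1)) *
                  ((k : ℝ) / vol Ω) ^ ((m : ℝ) / ((m : ℝ) - 1)))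
                ((Real.log (coeffC N m * ((k : ℝ) / vol Ω) + τ₀ ^ (m - 1) * Real.exp τ₀)
                  - ((m : ℝ) - 1) *
                      Real.log (Real.log (coeffC N m * ((k : ℝ) / vol Ω) + Real.exp 1))
                  - Real.log 2) ^ m)
              - coeffB N m
            ≤ eigenvalue m Ω k) ∧
        ((Odd m ∧ eigenvalue m Ω 1 < 0) →
          (2 / (N : ℝ)) ^ m *
              min
                ((coeffA N m / Real.exp τ₀) ^ ((m : ℝ) / ((m : ℝ) - 1)) *
                  (shiftP m Ω / vol Ω) ^ ((m : ℝ) / ((m : ℝ) - 1)) *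
                  (k : ℝ) ^ ((m : ℝ) / ((m : ℝ) - 1)))
                ((Real.log (coeffA N m * (shiftP m Ω / vol Ω) * (k : ℝ)
                      + τ₀ ^ (m - 1) * Real.exp τ₀)
                  - ((m : ℝ) - 1) *
                      Real.log (2 * Real.log (coeffA N m * (shiftP m Ω / vol Ω) * (k : ℝ)
                        + Real.exp 1))) ^ m)
              - shiftP m Ω
            ≤ eigenvalue m Ω k) := by
  have hm2 : (2 : ℝ) ≤ m := by exact_mod_cast hm
  obtain ⟨T, hTdef⟩ : ∃ T : ℝ, T = 2 ^ (m + 1) * m.factorial := ⟨_, rfl⟩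
  have hT1 : 1 ≤ T := by
    have h1 : (1 : ℝ) ≤ m.factorial := by
      exact_mod_cast Nat.one_le_iff_ne_zero.2 m.factorial_ne_zero
    have h2 : (1 : ℝ) ≤ 2 ^ (m + 1) := one_le_pow₀ (by norm_num)
    nlinarith
  -- The summand `m T` ensures `T^{m-1} e^T ≤ e^{τ₀}`, and `m² + 1` ensures that the logarithmic
  -- expression is nonnegative.
  obtain ⟨τ₀, hτ₀⟩ : ∃ τ₀ : ℝ, τ₀ = m * T + m ^ 2 + 1 := ⟨_, rfl⟩
  have hτ₀m : (m : ℝ) ^ 2 + 1 ≤ τ₀ := by nlinarith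
  have hτ₀1 : 1 < τ₀ := by nlinarith
  have hT₀ : T ^ (m - 1) * Real.exp T ≤ Real.exp τ₀ := by
    have h1 : T ≤ Real.exp T := by linarith [Real.add_one_le_exp T]
    calc _ ≤ Real.exp T ^ (m - 1) * Real.exp T := by gcongr
      _ = Real.exp (m * T) := by
        rw [← pow_succ, Nat.sub_add_cancel (by omega), Real.exp_nat_mul]
      _ ≤ _ := by
        rw [Real.exp_le_exp, hτ₀]
        nlinarith
  refine ⟨τ₀, hτ₀1, fun N hN Ω hΩ hne hb k hk => ?_⟩
  have hfin : MeasureTheory.volume Ω < ⊤ := hb.measure_lt_top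
  have : MeasureTheory.IsFiniteMeasure
      ((MeasureTheory.volume : MeasureTheory.Measure (EuclideanSpace ℝ (Fin N))).restrict Ω) :=
    ⟨by simpa using hfin⟩
  have hv : 0 < vol Ω := ENNReal.toReal_pos (hΩ.measure_pos _ hne).ne' hfin.ne
  have hA := coeffA_pos hN hm
  have hB := coeffB_pos hN hm
  have hN' : (0 : ℝ) < N := by exact_mod_cast hN
  have hk' : (0 : ℝ) < k := by exact_mod_cast (by omega : 0 < k)
  have hq : (0 : ℝ) < (2 / (N : ℝ)) ^ m := by positivity
  have hs : 0 ≤ (m : ℝ) / ((m : ℝ) - 1) := div_nonneg (by linarith) (by linarith)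
  -- Common core of both parts, with `p = b_m` or `p = P_m`. The fourth hypothesis is the trivial
  -- bound for small `X`; the last compares the logarithmic entry with `τ^m` when `τ ≥ τ₀`.
  have main : ∀ {p X f₁ f₂ : ℝ}, 0 < p → X = coeffA N m * p * (k / vol Ω) →
      f₁ = (X / Real.exp τ₀) ^ ((m : ℝ) / ((m : ℝ) - 1)) →
      (2 / (N : ℝ)) ^ m - p ≤ eigenvalue m Ω k →
      (∀ τ, τ₀ ≤ τ → τ ^ (m - 1) * Real.exp τ = X → f₂ ^ m ≤ τ ^ m) →
      (2 / (N : ℝ)) ^ m * min f₁ (f₂ ^ m) - p ≤ eigenvalue m Ω k := by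
    intro p X f₁ f₂ hp hX hf₁ htriv hf₂
    have hX0 : 0 < X := by rw [hX]; positivity
    rcases lt_or_ge X (T ^ (m - 1) * Real.exp T) with hlt | hge
    · have h1 : f₁ ≤ 1 := by
        rw [hf₁]
        refine Real.rpow_le_one (by positivity) ?_ hs
        rw [div_le_one (Real.exp_pos _)]
        exact hlt.le.trans hT₀
      have h2 := mul_le_mul_of_nonneg_left ((min_le_left f₁ (f₂ ^ m)).trans h1) hq.le
      linarith
    · obtain ⟨τ, hτ, hτX⟩ := exists_pow_mul_exp_eq (m - 1) hT1 hge
      have h1 := le_eigenvalue hΩ hne hv hN hm (by omega : 1 ≤ k) hp (hTdef ▸ hτ) (hτX.trans hX)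
      have h2 : min f₁ (f₂ ^ m) ≤ τ ^ m := by
        rcases le_total τ τ₀ with h | h
        · exact (min_le_left _ _).trans (hf₁ ▸ rpow_div_exp_le_pow hm (by linarith) h hτX)
        · exact (min_le_right _ _).trans (hf₂ τ h hτX)
      have h3 := mul_le_mul_of_nonneg_left h2 hq.le
      linarith
  constructor
  · intro hcase
    have hnn : 0 ≤ eigenvalue m Ω k := by
      rcases hcase with he | ⟨-, h⟩
      · exact eigenvalue_nonneg_of_even he (by omega)
      · exact h.trans (eigenvalue_one_le hΩ hne hv hN hm (by omega))
    refine main (X := coeffC N m * (k / vol Ω)) hB rfl ?_ ?_ ?_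
    · rw [← Real.mul_rpow (by rw [coeffC]; positivity) (by positivity)]
      congr 1
      ring
    · linarith [two_div_pow_le_coeffB hN hm]
    · intro τ hτ hX
      have h1 := log_add_sub_log_log_le hm hτ₀1.le hτ hX
      have h2 := log_add_sub_log_log_nonneg hm hτ₀m hτ hX
      gcongr
  · rintro ⟨hodd, hneg⟩
    have hP : 0 < shiftP m Ω := by rw [shiftP]; linarith
    refine main (X := coeffA N m * (shiftP m Ω / vol Ω) * k) hP (by ring) ?_ ?_ ?_
    · rw [← Real.mul_rpow (by positivity) (by positivity),
        ← Real.mul_rpow (by positivity) (by positivity)]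
      congr 1
      ring
    -- Here `-P_m = λ₁ - b_m`, so the trivial bound follows from `λ₁ ≤ λ_k` and `(2/N)^m ≤ b_m`.
    · have := eigenvalue_one_le hΩ hne hv hN hm (by omega : 1 ≤ k)
      rw [shiftP]
      linarith [two_div_pow_le_coeffB hN hm]
    · intro τ hτ hX
      -- Odd powers are monotone on the whole line, so the base need not be nonnegative. Since `m -
      -- 1 ≥ 1`, the factor 2 inside the iterated logarithm subtracts at least the `log 2` of the
      -- first part.
      refine hodd.strictMono_pow.monotone ?_
      refine le_trans ?_ (log_add_sub_log_log_le hm hτ₀1.le hτ hX)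
      set X := coeffA N m * (shiftP m Ω / vol Ω) * k
      have h1 : 1 ≤ Real.log (X + Real.exp 1) := by
        rw [add_comm]
        exact one_le_log_exp_one_add (by positivity)
      rw [Real.log_mul two_ne_zero (by positivity)]
      have := Real.log_pos one_lt_two
      nlinarith
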